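/- Let $K$ be a field of characteristic zero (for example a number field or its algebraic closure), let $n_1,\dots,n_k$ be positive integers, $n=\max\{n_1,\dots,n_k\}$ and $H=GL_{n_1}\times\dots\times GL_{n_k}$. An additive function (AF) in $H$ is a homomorphism of algebraic groups $\mathcal F:D_{\mathcal F}\to\mathbb G_a$ over $K$ whose domain $D_{\mathcal F}$ is a unipotent algebraic $K$-subgroup of $H$. A path from $\mathcal F$ to $\mathcal F'$ in $H$ is a finite sequence of AFs in $H$ from $\mathcal F$ to $\mathcal F'$ in which each AF $\mathcal Y$ is followed by an AF $\mathcal Y'$ such that one of the following holds: - (e) $D_{\mathcal Y}$ is a normal subgroup of $D_{\mathcal Y'}$ and $\mathcal Y'$ extends $\mathcal Y$; - (eu) with $C=D_{\mathcal Y}\cap D_{\mathcal Y'}$: $\mathcal Y|_C=\mathcal Y'|_C$, $[D_{\mathcal Y},D_{\mathcal Y'}]\subseteq C$, and $(y,x)\mapsto\mathcal Y(yxy^{-1}x^{-1})$ is a nondegenerate pairing between $D_{\mathcal Y}/C$ and $D_{\mathcal Y'}/C$; - (co) $\mathcal Y'=\gamma\mathcal Y$ for some $\gamma\in H(K)$,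 that is, $D_{\mathcal Y'}=\gamma D_{\mathcal Y}\gamma^{-1}$ and $\mathcal Y'(u)=\mathcal Y(\gamma^{-1}u\gamma)$. If $D_{\mathcal F}$ is the unipotent radical of a standard parabolic subgroup of $H$, let $J_{\mathcal F}=(J_1,\dots,J_k)$ be the unique element of $\mathrm{Lie}(H)$ whose transpose lies in $\mathrm{Lie}(D_{\mathcal F})$ and for which $\sum_i\mathrm{tr}(J_iu_i)=\mathcal F(u_1,\dots,u_k)$ for all $(u_1,\dots,u_k)\in D_{\mathcal F}$, and let $\Omega(J_{\mathcal F})$ be the nilpotent $H$-orbit of $J_{\mathcal F}$. Nilpotent orbits of $GL_N$ are identified with partitions of $N$ through the sizes of the Jordan blocks, and those of $H$ with $k$-tuples of partitions. Let $U_n$ be the group of upper triangular unipotent matrices in $GL_n$. Choose integers $x_i\ge 0$ with $x_i+n_i\le n$ for $1\le i\le k$, and let $\tilde\jmath:U_n\to H$ be the injective homomorphism whose $i$-th component maps $u$ to its diagonal block consisting of the rows and columns $x_i+1,\dots,x_i+n_i$ (it extends the inverse of $g\mapsto\mathrm{diag}(I_{x_i},g,I_{n-x_i-n_i})$). Let $\mathcal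 F$ be an AF with domain $U_n$, let $\tilde\jmath(\mathcal F)$ be the AF in $H$ with domain $\tilde\jmath(U_n)$ given by $\tilde\jmath(\mathcal F)(\tilde\jmath(u))=\mathcal F(u)$, and let $[b_1,b_2,\dots]=\Omega(J_{\mathcal F})$. Let $a=[a_{1,1},a_{2,1},\dots]\times\dots\times[a_{1,k},a_{2,k},\dots]$ be a nilpotent orbit of $H$. If there is a path in $H$ from $\tilde\jmath(\mathcal F)$ to an AF $\mathcal F'$ whose domain is the unipotent radical of a standard parabolic subgroup of $H$ and which satisfies $\Omega(J_{\mathcal F'})=a$, then $$\sum_i(b_i-1)\le\sum_{i,j}(a_{i,j}-1).$$ -/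

import Mathlib

/-! ### Products of general linear groups and additive functions -/

/-- The group of `K`-points of `H = GL_{m 0} × ⋯ × GL_{m (k-1)}`. -/
abbrev GLProd (K : Type*) [Field K] {k : ℕ} (m : Fin k → ℕ) : Type _ :=
  (i : Fin k) → GL (Fin (m i)) K

/-- The matrix coordinates of a point of `H`. -/
def GLProd.coord {K : Type*} [Field K] {k : ℕ} {m : Fin k → ℕ} (g : GLProd K m) :
    (Σ i : Fin k, Fin (m i) × Fin (m i)) → K :=
  fun s => (g s.1 : Matrix (Fin (m s.1)) (Fin (m s.1)) K) s.2.1 s.2.2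

/-- An additive function (AF) over `K` in `H`: a unipotent algebraic subgroup `dom` of `H`
together with a homomorphism of algebraic groups from `dom` to the additive group.
Over a field of characteristic zero a unipotent group is determined by its (Zariski dense)
`K`-points, so that algebraic subgroups are given as Zariski closed subgroups of `H(K)`, and
morphisms as polynomial functions of the matrix entries. -/
structure AF (K : Type*) [Field K] {k : ℕ} (m : Fin k → ℕ) where
  /-- the domain -/
  dom : Subgroup (GLProd K m)
  closed : ∃ S : Set (MvPolynomial (Σ i : Fin k, Fin (m i) × Fin (m i)) K),
    ∀ g : GLProd K m, g ∈ dom ↔ ∀ p ∈ S, MvPolynomial.eval g.coord p = 0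
  unipotent : ∀ g ∈ dom, ∀ i,
    IsNilpotent ((g i : Matrix (Fin (m i)) (Fin (m i)) K) - 1)
  /-- the function -/
  toFun : dom → K
  map_mul : ∀ u v : dom, toFun (u * v) = toFun u + toFun v
  regular : ∃ p : MvPolynomial (Σ i : Fin k, Fin (m i) × Fin (m i)) K,
    ∀ u : dom, toFun u = MvPolynomial.eval (GLProd.coord (u : GLProd K m)) p

/-! ### The steps and the paths -/

/-- An edge of an e-step (Fourier expansion): the additive function `F'` is one of the terms of
the expansion of `F` over a unipotent group normalizing the domain of `F`, that is, `F'` is an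
additive function with a bigger domain in which the domain of `F` is normal, and `F'`
extends `F`. (That the bigger domain fixes `F` follows from `F'` being additive.) -/
def AF.EStep {K : Type*} [Field K] {k : ℕ} {m : Fin k → ℕ} (F F' : AF K m) : Prop :=
  F.dom ≤ F'.dom ∧
  (∀ v ∈ F'.dom, ∀ u ∈ F.dom, v * u * v⁻¹ ∈ F.dom) ∧
  ∀ (u : GLProd K m) (hu : u ∈ F.dom) (hu' : u ∈ F'.dom), F'.toFun ⟨u, hu'⟩ = F.toFun ⟨u, hu⟩

/-- An eu-step (exchange of unipotent groups). With `C` the intersection of the two domains: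
`F` and `F'` agree on `C`, the commutators of `F.dom` and `F'.dom` lie in `C`, and
`(y, x) ↦ F (y * x * y⁻¹ * x⁻¹)` is a nondegenerate pairing between
`F.dom / C` and `F'.dom / C`. -/
def AF.EuStep {K : Type*} [Field K] {k : ℕ} {m : Fin k → ℕ} (F F' : AF K m) : Prop :=
  (∀ (u : GLProd K m) (hu : u ∈ F.dom) (hu' : u ∈ F'.dom),
    F'.toFun ⟨u, hu'⟩ = F.toFun ⟨u, hu⟩) ∧
  ∃ hC : ∀ y ∈ F.dom, ∀ x ∈ F'.dom, y * x * y⁻¹ * x⁻¹ ∈ F.dom ⊓ F'.dom,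
    (∀ (y : GLProd K m) (hy : y ∈ F.dom),
      (∀ (x : GLProd K m) (hx : x ∈ F'.dom), F.toFun ⟨_, (hC y hy x hx).1⟩ = 0) → y ∈ F'.dom) ∧
    (∀ (x : GLProd K m) (hx : x ∈ F'.dom),
      (∀ (y : GLProd K m) (hy : y ∈ F.dom), F.toFun ⟨_, (hC y hy x hx).1⟩ = 0) → x ∈ F.dom)

/-- A co-step (conjugation): `F' = γF` for some `γ ∈ H(K)`, where `γF` has the domain
`γ F.dom γ⁻¹` and `γF(u) = F(γ⁻¹uγ)`. -/
def AF.CoStep {K : Type*} [Field K] {k : ℕ} {m : Fin k → ℕ} (F F' : AF K m) : Prop :=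
  ∃ γ : GLProd K m,
    (∀ u : GLProd K m, u ∈ F'.dom ↔ γ⁻¹ * u * γ ∈ F.dom) ∧
    ∀ (u : GLProd K m) (hu' : u ∈ F'.dom) (hu : γ⁻¹ * u * γ ∈ F.dom),
      F'.toFun ⟨u, hu'⟩ = F.toFun ⟨γ⁻¹ * u * γ, hu⟩

/-- There is a path from `F` to `F'` inside `H`: a finite sequence (possibly empty) of edges,
each belonging to an e-step, an eu-step or a co-step. -/
def AF.HasPath {K : Type*} [Field K] {k : ℕ} {m : Fin k → ℕ} (F F' : AF K m) : Prop :=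
  Relation.ReflTransGen (fun G G' : AF K m => G.EStep G' ∨ G.EuStep G' ∨ G.CoStep G') F F'

/-! ### Unipotent radicals of standard parabolic subgroups -/

/-- The group of `g ∈ H` such that each `g i - 1` is supported on the entries `(r, c)` with
`β i r < β i c`. For `β i` monotone this is the unipotent radical of the standard parabolic
subgroup of `H` whose Levi blocks are the fibres of the `β i`. -/
def blockUnipotent (K : Type*) [Field K] {k : ℕ} {m : Fin k → ℕ} (β : (i : Fin k) → Fin (m i) → ℕ) :
    Subgroup (GLProd K m) where
  carrier := {g | ∀ i r c, ¬ β i r < β i c →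
    (g i : Matrix (Fin (m i)) (Fin (m i)) K) r c = (1 : Matrix (Fin (m i)) (Fin (m i)) K) r c}
  one_mem' := fun i r c _ => by simp
  mul_mem' := by
    intro g h hg hh i r c hrc
    have key : (g i : Matrix (Fin (m i)) (Fin (m i)) K) * (h i).1 - 1
        = ((g i).1 - 1) * ((h i).1 - 1) + ((g i).1 - 1) + ((h i).1 - 1) := by noncomm_ring
    have e := congrFun (congrFun key r) c
    have h1 : (((g i).1 - 1) * ((h i).1 - 1)) r c = 0 := by
      rw [Matrix.mul_apply]
      refine Finset.sum_eq_zero fun a _ => ?_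
      by_cases h1 : β i r < β i a
      · have h2 : ¬ β i a < β i c := fun h2 => hrc (h1.trans h2)
        simp [Matrix.sub_apply, hh i a c h2]
      · simp [Matrix.sub_apply, hg i r a h1]
    simp only [Matrix.add_apply, Matrix.sub_apply, h1, hg i r c hrc, hh i r c hrc, sub_self,
      add_zero] at e
    exact sub_eq_zero.mp e
  inv_mem' := by
    intro g hg i r c hrc
    have hbt : Matrix.BlockTriangular (g i : Matrix (Fin (m i)) (Fin (m i)) K) (β i) := by
      intro a b hab
      rw [hg i a b (not_lt.mpr hab.le), Matrix.one_apply_ne]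
      rintro rfl
      exact lt_irrefl _ hab
    have : Invertible (g i : Matrix (Fin (m i)) (Fin (m i)) K) := (g i).isUnit.invertible
    have hinv : Matrix.BlockTriangular ((g i)⁻¹ : GL (Fin (m i)) K).1 (β i) := by
      rw [Matrix.coe_units_inv]
      exact Matrix.blockTriangular_inv_of_blockTriangular hbt
    have key : ((g i)⁻¹ : GL (Fin (m i)) K).1
        = 1 - ((g i).1 - 1) * ((g i)⁻¹ : GL (Fin (m i)) K).1 := by
      rw [sub_mul, one_mul, Units.mul_inv]
      abel
    have h1 : (((g i).1 - 1) * ((g i)⁻¹ : GL (Fin (m i)) K).1) r c = 0 := by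
      rw [Matrix.mul_apply]
      refine Finset.sum_eq_zero fun a _ => ?_
      by_cases h1 : β i r < β i a
      · rw [hinv (show β i c < β i a by omega), mul_zero]
      · simp [Matrix.sub_apply, hg i r a h1]
    have e := congrFun (congrFun key r) c
    rw [Matrix.sub_apply, h1, sub_zero] at e
    exact e

/-- `U_n`, the group of upper triangular unipotent matrices of `GL_n`
(`GL_n` being viewed as a product with one factor). -/
abbrev upperUnipotent (K : Type*) [Field K] (n : ℕ) :
    Subgroup (GLProd K (fun _ : Fin 1 => n)) :=
  blockUnipotent K (fun _ r => (r : ℕ))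

/-- The domain of `F` is the unipotent radical of a standard parabolic subgroup of `H`
(given by a composition of the size of each factor of `H`). -/
def AF.IsParabolic {K : Type*} [Field K] {k : ℕ} {m : Fin k → ℕ} (F : AF K m) : Prop :=
  ∃ c : (i : Fin k) → Composition (m i),
    F.dom = blockUnipotent K (fun i r => ((c i).index r : ℕ))

/-! ### Nilpotent orbits and the matrix `J_F` -/

/-- The nilpotent Jordan block of size `d`. -/
def nilJordanBlock (K : Type*) [Field K] (d : ℕ) : Matrix (Fin d) (Fin d) K :=
  Matrix.of fun r c => if (r : ℕ) + 1 = (c : ℕ) then 1 else 0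

/-- The block diagonal matrix with nilpotent Jordan blocks of sizes the parts of `p`. -/
noncomputable def nilJordanMatrix (K : Type*) [Field K] {n : ℕ} (p : Nat.Partition n) :
    Matrix (Σ t : Fin p.parts.toList.length, Fin (p.parts.toList.get t))
      (Σ t : Fin p.parts.toList.length, Fin (p.parts.toList.get t)) K :=
  Matrix.blockDiagonal' fun t => nilJordanBlock K (p.parts.toList.get t)

/-- `A` belongs to the nilpotent orbit of `GL_n` that corresponds to the partition `p`:
it is conjugate to the block diagonal matrix with nilpotent Jordan blocks of sizes the
parts of `p`. -/
def HasJordanType {K : Type*} [Field K] {n : ℕ} (A : Matrix (Fin n) (Fin n) K)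
    (p : Nat.Partition n) : Prop :=
  ∃ (e : (Σ t : Fin p.parts.toList.length, Fin (p.parts.toList.get t)) ≃ Fin n)
    (g : GL (Fin n) K),
    A = g.1 * Matrix.reindex e e (nilJordanMatrix K p) * (g⁻¹ : GL (Fin n) K).1

/-- `J = J_F`: `∑ i, tr (J i * u i) = F u` for all `u` in the domain `D` of `F`, and the transpose
of `J` lies in the Lie algebra of `D`. This is used only when `D` is generated by root groups;
then the Lie algebra of `D` is `{u - 1 | u ∈ D}`, and exactly one `J` has both properties. -/
def AF.IsJ {K : Type*} [Field K] {k : ℕ} {m : Fin k → ℕ} (F : AF K m)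
    (J : (i : Fin k) → Matrix (Fin (m i)) (Fin (m i)) K) : Prop :=
  (∀ (u : GLProd K m) (hu : u ∈ F.dom), ∑ i, (J i * (u i).1).trace = F.toFun ⟨u, hu⟩) ∧
  ∃ u ∈ F.dom, ∀ i, (J i).transpose = (u i).1 - 1

/-- The orbit of `J_F` is the nilpotent orbit of `H` given by the partitions `a i`. -/
def AF.HasOrbit {K : Type*} [Field K] {k : ℕ} {m : Fin k → ℕ} (F : AF K m)
    (a : (i : Fin k) → Nat.Partition (m i)) : Prop :=
  ∃ J : (i : Fin k) → Matrix (Fin (m i)) (Fin (m i)) K, F.IsJ J ∧ ∀ i, HasJordanType (J i) (a i)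

/-! ### The diagonal embedding of `U_n` in `H` -/

/-- The diagonal block of size `d` that starts after the first `x` rows and columns. On the
upper triangular matrices this is a homomorphism; it extends the inverse of the embedding
`g ↦ diag(I_x, g, I_{n-x-d})` restricted to upper triangular matrices. -/
def diagBlock {K : Type*} {n d : ℕ} (x : ℕ) (hx : x + d ≤ n) (A : Matrix (Fin n) (Fin n) K) :
    Matrix (Fin d) (Fin d) K :=
  A.submatrix (fun r => ⟨x + r, by omega⟩) (fun r => ⟨x + r, by omega⟩)

theorem diagBlock_one {K : Type*} [Field K] {n d : ℕ} (x : ℕ) (hx : x + d ≤ n) :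
    diagBlock x hx (1 : Matrix (Fin n) (Fin n) K) = 1 := by
  ext r c
  simp [diagBlock, Matrix.one_apply, Fin.ext_iff]

theorem diagBlock_mul {K : Type*} [Field K] {n d : ℕ} (x : ℕ) (hx : x + d ≤ n)
    (A B : Matrix (Fin n) (Fin n) K) (hA : ∀ r c, c < r → A r c = 0)
    (hB : ∀ r c, c < r → B r c = 0) :
    diagBlock x hx (A * B) = diagBlock x hx A * diagBlock x hx B := by
  ext r c
  simp only [diagBlock, Matrix.submatrix_apply, Matrix.mul_apply]
  symm
  refine Finset.sum_of_injOn (fun a : Fin d => (⟨x + a, by omega⟩ : Fin n)) ?_ ?_ ?_ ?_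
  · intro a _ b _ hab
    simpa [Fin.ext_iff] using hab
  · intro a _
    simp
  · intro a _ ha
    by_cases h1 : (a : ℕ) < x
    · rw [hA _ _ (by rw [Fin.lt_def]; simp; omega), zero_mul]
    · by_cases h2 : x + d ≤ (a : ℕ)
      · rw [hB _ _ (by rw [Fin.lt_def]; simp; omega), mul_zero]
      · refine absurd ?_ ha
        refine ⟨⟨(a : ℕ) - x, by omega⟩, by simp, ?_⟩
        simp only [Fin.ext_iff]
        omega
  · intro a _
    rfl

theorem upperUnipotent_lower {K : Type*} [Field K] {n : ℕ} {u : GLProd K (fun _ : Fin 1 => n)}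
    (hu : u ∈ upperUnipotent K n) (r c : Fin n) (h : c < r) : (u 0).1 r c = 0 := by
  have := hu 0 r c (not_lt.mpr (Fin.lt_def.mp h).le)
  rw [this, Matrix.one_apply_ne h.ne']

/-- `h = (j_1⁻¹ × ⋯ × j_k⁻¹)(u)`: the `i`-th component of `h` is the diagonal block of `u`
of size `m i` that starts after the first `x i` rows and columns. -/
def IsDiag {K : Type*} [Field K] {n k : ℕ} {m : Fin k → ℕ} (x : Fin k → ℕ)
    (hx : ∀ i, x i + m i ≤ n) (u : GLProd K (fun _ : Fin 1 => n)) (h : GLProd K m) : Prop :=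
  ∀ i, (h i).1 = diagBlock (x i) (hx i) (u 0).1

theorem IsDiag.full {K : Type*} [Field K] {k : ℕ} {m : Fin k → ℕ} {x : Fin k → ℕ} {i₀ : Fin k}
    {hx : ∀ i, x i + m i ≤ m i₀} {u : GLProd K (fun _ : Fin 1 => m i₀)} {h : GLProd K m}
    (huh : IsDiag x hx u h) : u = fun _ => h i₀ := by
  funext z
  obtain rfl : z = 0 := Subsingleton.elim _ _
  have h0 : x i₀ = 0 := by have := hx i₀; omega
  refine Units.ext ?_
  rw [huh i₀]
  ext r c
  simp [diagBlock, h0]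

theorem IsDiag.unique {K : Type*} [Field K] {n k : ℕ} {m : Fin k → ℕ} {x : Fin k → ℕ}
    {hx : ∀ i, x i + m i ≤ n} (hn : IsGreatest (Set.range m) n)
    {u v : GLProd K (fun _ : Fin 1 => n)} {h : GLProd K m}
    (hu : IsDiag x hx u h) (hv : IsDiag x hx v h) : u = v := by
  obtain ⟨⟨i₀, rfl⟩, -⟩ := hn
  rw [hu.full, hv.full]

theorem IsDiag.one {K : Type*} [Field K] {n k : ℕ} {m : Fin k → ℕ} {x : Fin k → ℕ}
    (hx : ∀ i, x i + m i ≤ n) : IsDiag (K := K) x hx 1 1 := by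
  intro i
  exact (diagBlock_one (x i) (hx i)).symm

theorem IsDiag.mul {K : Type*} [Field K] {n k : ℕ} {m : Fin k → ℕ} {x : Fin k → ℕ}
    {hx : ∀ i, x i + m i ≤ n} {u v : GLProd K (fun _ : Fin 1 => n)} {g h : GLProd K m}
    (hu : u ∈ upperUnipotent K n) (hv : v ∈ upperUnipotent K n)
    (hug : IsDiag x hx u g) (hvh : IsDiag x hx v h) : IsDiag x hx (u * v) (g * h) := by
  intro i
  have := diagBlock_mul (x i) (hx i) (u 0).1 (v 0).1 (upperUnipotent_lower hu)
    (upperUnipotent_lower hv)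
  simp only [Pi.mul_apply, Units.val_mul, hug i, hvh i, this]

theorem IsDiag.inv {K : Type*} [Field K] {n k : ℕ} {m : Fin k → ℕ} {x : Fin k → ℕ}
    {hx : ∀ i, x i + m i ≤ n} {u : GLProd K (fun _ : Fin 1 => n)} {g : GLProd K m}
    (hu : u ∈ upperUnipotent K n) (hug : IsDiag x hx u g) : IsDiag x hx u⁻¹ g⁻¹ := by
  intro i
  have h1 := diagBlock_mul (x i) (hx i) (u 0).1 (u⁻¹ 0).1 (upperUnipotent_lower hu)
    (upperUnipotent_lower (inv_mem hu))
  have h2 : (u 0).1 * (u⁻¹ 0).1 = 1 := by simp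
  rw [h2, diagBlock_one, ← hug i] at h1
  calc (g⁻¹ i).1 = (g⁻¹ i).1 * ((g i).1 * diagBlock (x i) (hx i) (u⁻¹ 0).1) := by
        rw [← h1, mul_one]
    _ = diagBlock (x i) (hx i) (u⁻¹ 0).1 := by
        rw [← mul_assoc]
        simp

/-- The additive function `ȷ(F)` in `H`, for `ȷ = j_1⁻¹ × ⋯ × j_k⁻¹` and `F` an additive
function with domain in `U_n`: its domain is the image `ȷ(D)` of the domain `D` of `F`, and it
maps `ȷ(u)` to `F(u)` for each `u ∈ D`. -/
noncomputable def AF.diag {K : Type*} [Field K] {n k : ℕ} {m : Fin k → ℕ}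
    (hn : IsGreatest (Set.range m) n) (x : Fin k → ℕ) (hx : ∀ i, x i + m i ≤ n)
    (F : AF K (fun _ : Fin 1 => n)) (hF : F.dom ≤ upperUnipotent K n) : AF K m where
  dom :=
    { carrier := {h | ∃ u ∈ F.dom, IsDiag x hx u h}
      one_mem' := ⟨1, one_mem _, IsDiag.one hx⟩
      mul_mem' := by
        rintro g h ⟨u, hu, hug⟩ ⟨v, hv, hvh⟩
        exact ⟨u * v, mul_mem hu hv, hug.mul (hF hu) (hF hv) hvh⟩
      inv_mem' := by
        rintro g ⟨u, hu, hug⟩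
        exact ⟨u⁻¹, inv_mem hu, hug.inv (hF hu)⟩ }
  closed := by
    obtain ⟨⟨i₀, rfl⟩, -⟩ := hn
    obtain ⟨S, hS⟩ := F.closed
    have h0 : x i₀ = 0 := by have := hx i₀; omega
    let φ : (Σ _ : Fin 1, Fin (m i₀) × Fin (m i₀)) → (Σ i : Fin k, Fin (m i) × Fin (m i)) :=
      fun s => ⟨i₀, s.2⟩
    refine ⟨(MvPolynomial.rename φ '' S) ∪
      {p | ∃ (i : Fin k) (r c : Fin (m i)), p = MvPolynomial.X ⟨i, (r, c)⟩ -
        MvPolynomial.X ⟨i₀, (⟨x i + r, by have := hx i; omega⟩,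
          ⟨x i + c, by have := hx i; omega⟩)⟩}, fun g => ?_⟩
    have hφ : ∀ p : MvPolynomial (Σ _ : Fin 1, Fin (m i₀) × Fin (m i₀)) K,
        MvPolynomial.eval g.coord (MvPolynomial.rename φ p) =
          MvPolynomial.eval (GLProd.coord (m := fun _ : Fin 1 => m i₀) fun _ => g i₀) p := by
      intro p
      rw [MvPolynomial.eval_rename]
      rfl
    constructor
    · rintro ⟨u, hu, hug⟩ p (⟨q, hq, rfl⟩ | ⟨i, r, c, rfl⟩)
      · rw [hφ, ← hug.full]
        exact (hS u).mp hu q hq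
      · have h1 := congrFun (congrFun (hug i) r) c
        rw [hug.full] at h1
        simp only [map_sub, MvPolynomial.eval_X, GLProd.coord]
        rw [h1]
        simp [diagBlock]
    · intro h
      refine ⟨fun _ => g i₀, (hS _).mpr fun p hp => ?_, fun i => ?_⟩
      · rw [← hφ]
        exact h _ (Or.inl ⟨p, hp, rfl⟩)
      · ext r c
        have h1 := h _ (Or.inr ⟨i, r, c, rfl⟩)
        simp only [map_sub, MvPolynomial.eval_X, GLProd.coord] at h1
        exact sub_eq_zero.mp h1
  unipotent := by
    rintro g ⟨u, hu, hug⟩ i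
    have hup := hF hu
    -- a strictly upper triangular matrix is nilpotent
    refine ⟨m i, ?_⟩
    have hN : ∀ r c : Fin (m i), ¬ r < c → ((g i).1 - 1) r c = 0 := by
      intro r c hrc
      have hr : x i + r < n := by have := hx i; omega
      have hc : x i + c < n := by have := hx i; omega
      have h1 := hup 0 ⟨x i + r, hr⟩ ⟨x i + c, hc⟩ (by simp; exact not_lt.mp hrc)
      rw [← diagBlock_one (x i) (hx i), hug i]
      simp only [Matrix.sub_apply, diagBlock, Matrix.submatrix_apply]
      exact sub_eq_zero.mpr h1
    have hpow : ∀ (t : ℕ) (r c : Fin (m i)), (c : ℕ) < r + t →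
        (((g i).1 - 1) ^ t) r c = 0 := by
      intro t
      induction t with
      | zero =>
        intro r c h
        rw [pow_zero, Matrix.one_apply_ne]
        rintro rfl
        omega
      | succ t ih =>
        intro r c h
        rw [pow_succ, Matrix.mul_apply]
        refine Finset.sum_eq_zero fun a _ => ?_
        by_cases h1 : (a : ℕ) < r + t
        · rw [ih r a h1, zero_mul]
        · rw [hN a c (by rw [Fin.lt_def]; omega), mul_zero]
    ext r c
    exact hpow _ r c (by omega)
  toFun := fun g => F.toFun ⟨g.2.choose, g.2.choose_spec.1⟩
  map_mul := by
    intro g h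
    rw [← F.map_mul]
    congr 1
    refine Subtype.ext ?_
    exact IsDiag.unique hn (g * h).2.choose_spec.2
      (g.2.choose_spec.2.mul (hF g.2.choose_spec.1) (hF h.2.choose_spec.1) h.2.choose_spec.2)
  regular := by
    obtain ⟨⟨i₀, rfl⟩, -⟩ := hn
    obtain ⟨p, hp⟩ := F.regular
    refine ⟨MvPolynomial.rename (fun s => ⟨i₀, s.2⟩) p, fun g => ?_⟩
    rw [hp, MvPolynomial.eval_rename]
    have := g.2.choose_spec.2.full
    simp only [this]
    rfl

theorem AF.mem_diag {K : Type*} [Field K] {n k : ℕ} {m : Fin k → ℕ}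
    {hn : IsGreatest (Set.range m) n} {x : Fin k → ℕ} {hx : ∀ i, x i + m i ≤ n}
    {F : AF K (fun _ : Fin 1 => n)} {hF : F.dom ≤ upperUnipotent K n} {h : GLProd K m} :
    h ∈ (F.diag hn x hx hF).dom ↔ ∃ u ∈ F.dom, IsDiag x hx u h :=
  Iff.rfl

theorem AF.diag_apply {K : Type*} [Field K] {n k : ℕ} {m : Fin k → ℕ}
    (hn : IsGreatest (Set.range m) n) (x : Fin k → ℕ) (hx : ∀ i, x i + m i ≤ n)
    (F : AF K (fun _ : Fin 1 => n)) (hF : F.dom ≤ upperUnipotent K n)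
    (u : GLProd K (fun _ : Fin 1 => n)) (hu : u ∈ F.dom) (h : GLProd K m)
    (huh : IsDiag x hx u h) :
    (F.diag hn x hx hF).toFun ⟨h, AF.mem_diag.mpr ⟨u, hu, huh⟩⟩ = F.toFun ⟨u, hu⟩ := by
  have hmem : ∃ u ∈ F.dom, IsDiag x hx u h := ⟨u, hu, huh⟩
  change F.toFun ⟨Exists.choose hmem, _⟩ = _
  congr 1
  exact Subtype.ext (IsDiag.unique hn (Exists.choose_spec hmem).2 huh)

/-! Both sides are ranks: a nilpotent matrix whose Jordan blocks have sizes p_i has rank ∑ (p_i - 1)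
(`HasJordanType.rank_eq`). So the rank of J_F must be bounded by the sum of the ranks of the
components of J_{F'}.

Say that X represents an AF if N ↦ tr(XN) is its differential on the Lie algebra of its domain. The
key fact is that representatives travel backwards along a path up to conjugation by H(K)
(`AF.HasPath.exists_represents`). For an e-step one restricts the functional, and for a co-step one
conjugates X. For an eu-step from Y to Y' with X representing Y', the functional dY - tr(X ·) on
Lie(D_Y) vanishes on the kernel of the commutator pairing. By duality it has the form N ↦ dY'(Ad(x)N
- N) = tr(X(Ad(x)N - N)) for some x in D_{Y'}, so Ad(x⁻¹)X represents Y.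

Hence some conjugate X of J_{F'} represents the diagonal image of F. Let T be the sum of the X_i
placed in their diagonal blocks. Then T agrees with J_F strictly below the diagonal. As F is
additive on U_n, J_F is supported on the subdiagonal, so a triangular minor gives rank J_F ≤ rank T
≤ ∑ rank X_i.

The Lie theory uses only polynomial curves: closed subgroups and AFs are given by polynomials, so
what holds for infinitely many parameters holds for all, in particular at t = 0. -/

/-! ### Truncated exponential and logarithm series -/

open Polynomial in
/-- The truncation of the exponential series after the term of degree `d + 1`. -/
noncomputable def expPoly (K : Type*) [Field K] (d : ℕ) : K[X] :=
  ∑ k ∈ Finset.range (d + 2), C ((k.factorial : K)⁻¹) * X ^ k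

open Polynomial in
/-- The truncation of the series of `log (1 + X)` after the term of degree `d + 1`. -/
noncomputable def logPoly (K : Type*) [Field K] (d : ℕ) : K[X] :=
  ∑ k ∈ Finset.range (d + 1), C ((-1) ^ k * ((k + 1 : ℕ) : K)⁻¹) * X ^ (k + 1)

open Polynomial in
theorem derivative_expPoly (K : Type*) [Field K] [CharZero K] (d : ℕ) :
    derivative (expPoly K d) = expPoly K d - C (((d + 1).factorial : K)⁻¹) * X ^ (d + 1) := by
  unfold expPoly
  rw [Finset.sum_range_succ _ (d + 1), add_sub_cancel_right, ← Finset.sum_range_succ,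
    Finset.sum_range_succ', derivative_add, derivative_sum]
  simp only [derivative_mul, derivative_C, zero_mul, zero_add, derivative_X_pow, pow_zero, mul_one,
    add_zero]
  refine Finset.sum_congr rfl fun k _ => ?_
  rw [Nat.add_sub_cancel, ← mul_assoc, ← C_mul]
  congr 2
  have h1 : (k.factorial : K) ≠ 0 := by exact_mod_cast k.factorial_ne_zero
  have h2 : ((k + 1 : ℕ) : K) ≠ 0 := by exact_mod_cast k.succ_ne_zero
  rw [Nat.factorial_succ]
  push_cast at h2 ⊢
  field_simp

open Polynomial in
theorem derivative_logPoly (K : Type*) [Field K] [CharZero K] (d : ℕ) :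
    (1 + X) * derivative (logPoly K d) = 1 - (-X) ^ (d + 1) := by
  have h : derivative (logPoly K d) = ∑ k ∈ Finset.range (d + 1), (-X) ^ k := by
    rw [logPoly, derivative_sum]
    refine Finset.sum_congr rfl fun k _ => ?_
    have h2 : ((k + 1 : ℕ) : K) ≠ 0 := by exact_mod_cast k.succ_ne_zero
    rw [derivative_C_mul, derivative_X_pow, Nat.add_sub_cancel, ← mul_assoc, ← C_mul, mul_assoc,
      inv_mul_cancel₀ h2, mul_one, neg_pow (X : K[X]) k]
    simp
  have := mul_neg_geom_sum (-X : K[X]) (d + 1)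
  rw [sub_neg_eq_add] at this
  rw [h, this]

-- The composite G satisfies (1 + X) G' ≡ G modulo X ^ (d + 1) and has constant term 1. In
-- characteristic zero this determines its coefficients through degree d + 1, and 1 + X has the same
-- ones.
open Polynomial in
theorem X_pow_dvd_expPoly_comp_logPoly (K : Type*) [Field K] [CharZero K] (d : ℕ) :
    X ^ (d + 2) ∣ (expPoly K d).comp (logPoly K d) - (1 + X) := by
  set L := logPoly K d with hL
  set G := (expPoly K d).comp L with hG
  have hXL : X ∣ L := by
    refine Finset.dvd_sum fun k _ => ?_
    exact Dvd.intro_left (C _ * X ^ k) (by ring)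
  obtain ⟨Q, hQ⟩ : X ^ (d + 1) ∣ (1 + X) * derivative G - G := by
    have h1 : derivative G = (G - C (((d + 1).factorial : K)⁻¹) * L ^ (d + 1)) * derivative L := by
      rw [hG, derivative_comp, derivative_expPoly, sub_comp, mul_comp, C_comp, pow_comp, X_comp,
        mul_comm]
    have h2 : (1 + X) * derivative G - G =
        X ^ (d + 1) * (-(-1) ^ (d + 1) * G)
          - L ^ (d + 1) * (C (((d + 1).factorial : K)⁻¹) * ((1 + X) * derivative L)) := by
      have h3 := derivative_logPoly K d
      rw [h1]
      linear_combination G * h3 - G * (neg_pow (X : K[X]) (d + 1))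
    rw [h2]
    exact dvd_sub (Dvd.intro _ rfl) ((pow_dvd_pow_of_dvd hXL _).mul_right _)
  have h0 : G.coeff 0 = 1 := by
    obtain ⟨q, hq⟩ := hXL
    rw [coeff_zero_eq_eval_zero, hG, eval_comp, hq]
    simp [expPoly, eval_finsetSum, Finset.sum_range_succ']
  -- Comparison of the coefficients of X ^ k in the differential equation. The factor 1 - k vanishes
  -- at k = 1, which stops the recursion after the linear term.
  have hrec : ∀ k < d + 1, G.coeff (k + 1) * (k + 1) + G.coeff k * k = G.coeff k := by
    intro k hk
    have := congrArg (fun p => coeff p k) hQ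
    simp only [coeff_sub, add_mul, one_mul, coeff_add, coeff_derivative, coeff_X_pow_mul',
      if_neg (not_le.mpr hk)] at this
    have h4 : (X * derivative G).coeff k = G.coeff k * k := by
      cases k with
      | zero => simp
      | succ k => rw [coeff_X_mul, coeff_derivative]; push_cast; ring
    rw [h4] at this
    exact sub_eq_zero.mp this
  have h1 : G.coeff 1 = 1 := by simpa [h0] using hrec 0 (by omega)
  have hk : ∀ k, k + 2 < d + 2 → G.coeff (k + 2) = 0 := by
    intro k
    induction k with
    | zero =>
      intro hk
      have := hrec 1 (by omega)
      simp only [h1, Nat.cast_one] at this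
      have h2 : G.coeff 2 * 2 = 0 := by linear_combination this
      simpa using h2
    | succ k ih =>
      intro hk
      have := hrec (k + 2) (by omega)
      rw [ih (by omega), zero_mul, add_zero] at this
      have h5 : ((k + 2 : ℕ) : K) + 1 ≠ 0 := by exact_mod_cast (k + 2).succ_ne_zero
      exact (mul_eq_zero.mp this).resolve_right h5
  rw [X_pow_dvd_iff]
  intro k hkd
  rcases k with _ | _ | k
  · simp [h0]
  · simp [h1, coeff_one]
  · simp [hk k hkd, coeff_one, coeff_X]

/-! ### Exponential and logarithm of nilpotent elements -/

theorem conj_pow_of_mul_eq_one {A : Type*} [Monoid A] {N g h : A} (hgh : h * g = 1)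
    (hhg : g * h = 1) (k : ℕ) : (g * N * h) ^ k = g * N ^ k * h := by
  induction k with
  | zero => simp [hhg]
  | succ k ih =>
    rw [pow_succ, ih, pow_succ]
    simp only [mul_assoc]
    rw [← mul_assoc h g, hgh, one_mul]

section TruncExp

variable {K A : Type*} [Field K] [Ring A] [Algebra K A]

/-- The exponential of an element `N` with `N ^ (d + 2) = 0`. -/
noncomputable def truncExp (K : Type*) {A : Type*} [Field K] [Ring A] [Algebra K A] (d : ℕ)
    (N : A) : A :=
  ∑ k ∈ Finset.range (d + 2), (k.factorial : K)⁻¹ • N ^ k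

/-- The polynomial in `t` with values in `A` that extends `(exp (t N) - 1) / t`. -/
noncomputable def expQuot (d : ℕ) (t : K) (N : A) : A :=
  ∑ k ∈ Finset.range (d + 1), (((k + 1).factorial : K)⁻¹ * t ^ k) • N ^ (k + 1)

/-- The polynomial in `t` and `M` that extends `log (1 + t M) / t`. -/
noncomputable def logQuot (d : ℕ) (t : K) (M : A) : A :=
  ∑ k ∈ Finset.range (d + 1), (((-1) ^ k * ((k + 1 : ℕ) : K)⁻¹) * t ^ k) • M ^ (k + 1)

theorem expQuot_zero (d : ℕ) (N : A) : expQuot d (0 : K) N = N := by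
  simp [expQuot, Finset.sum_range_succ']

theorem logQuot_zero (d : ℕ) (M : A) : logQuot d (0 : K) M = M := by
  simp [logQuot, Finset.sum_range_succ']

theorem truncExp_smul (d : ℕ) (t : K) (N : A) :
    truncExp K d (t • N) = 1 + t • expQuot d t N := by
  rw [truncExp, Finset.sum_range_succ', expQuot, Finset.smul_sum, add_comm]
  congr 1
  · simp
  · refine Finset.sum_congr rfl fun k _ => ?_
    rw [smul_pow, smul_smul, smul_smul]
    congr 1
    ring

theorem logQuot_one_smul (d : ℕ) (t : K) (M : A) :
    logQuot d (1 : K) (t • M) = t • logQuot d t M := by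
  rw [logQuot, logQuot, Finset.smul_sum]
  refine Finset.sum_congr rfl fun k _ => ?_
  rw [smul_pow, smul_smul, smul_smul]
  congr 1
  ring

theorem logQuot_one_eq_aeval (d : ℕ) (M : A) :
    logQuot d (1 : K) M = Polynomial.aeval M (logPoly K d) := by
  simp [logQuot, logPoly, Algebra.smul_def]

theorem truncExp_eq_aeval (d : ℕ) (N : A) :
    truncExp K d N = Polynomial.aeval N (expPoly K d) := by
  simp [truncExp, expPoly, Algebra.smul_def]

theorem isNilpotent_logQuot (d : ℕ) {M : A} (hM : IsNilpotent M) :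
    IsNilpotent (logQuot d (1 : K) M) := by
  have h : logQuot d (1 : K) M =
      M * Polynomial.aeval M (Polynomial.divX (logPoly K d)) := by
    rw [logQuot_one_eq_aeval]
    conv_lhs => rw [← Polynomial.X_mul_divX_add (logPoly K d)]
    simp [logPoly]
  rw [h]
  refine Commute.isNilpotent_mul_right ?_ hM
  simpa using (Polynomial.commute_X (Polynomial.divX (logPoly K d))).map (Polynomial.aeval M)

theorem truncExp_logQuot [CharZero K] (d : ℕ) {M : A} (hM : M ^ (d + 2) = 0) :
    truncExp K d (logQuot d (1 : K) M) = 1 + M := by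
  obtain ⟨Q, hQ⟩ := X_pow_dvd_expPoly_comp_logPoly K d
  have := congrArg (Polynomial.aeval M) hQ
  rw [map_mul, map_pow, Polynomial.aeval_X, hM, zero_mul, map_sub, Polynomial.aeval_comp,
    ← logQuot_one_eq_aeval, ← truncExp_eq_aeval, sub_eq_zero] at this
  rw [this]
  simp

theorem truncExp_zero (d : ℕ) : truncExp K d (0 : A) = 1 := by
  simp [truncExp, Finset.sum_range_succ']

theorem truncExp_add_smul [CharZero K] (d : ℕ) {N : A} (hN : N ^ (d + 2) = 0) (s t : K) :
    truncExp K d ((s + t) • N) = truncExp K d (s • N) * truncExp K d (t • N) := by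
  -- `IsNilpotent.exp` has rational coefficients, so scalars are restricted from K to ℚ.
  let _ : Module ℚ A := Module.compHom A (algebraMap ℚ K)
  have h : ∀ r : K, truncExp K d (r • N) = IsNilpotent.exp (r • N) := by
    intro r
    rw [IsNilpotent.exp_eq_sum (k := d + 2) (by rw [smul_pow, hN, smul_zero]), truncExp]
    refine Finset.sum_congr rfl fun k _ => ?_
    rw [← Rat.cast_smul_eq_qsmul K]
    simp
  have hnil : ∀ r : K, IsNilpotent (r • N) := fun r => ⟨d + 2, by rw [smul_pow, hN, smul_zero]⟩
  rw [h, h, h, add_smul]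
  exact IsNilpotent.exp_add_of_commute
    (((Commute.refl N).smul_left s).smul_right t) (hnil s) (hnil t)

theorem truncExp_conj (d : ℕ) (N : A) {g h : A} (hgh : h * g = 1) (hhg : g * h = 1) :
    truncExp K d (g * N * h) = g * truncExp K d N * h := by
  simp only [truncExp, conj_pow_of_mul_eq_one hgh hhg, Finset.mul_sum, Finset.sum_mul, mul_smul_comm, smul_mul_assoc]

end TruncExp

/-! ### Polynomial functions of one parameter -/

/-- The polynomial functions on `K`. -/
noncomputable def polyFun (K : Type*) [Field K] : Subalgebra K (K → K) :=
  (Polynomial.aeval (id : K → K)).range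

theorem mem_polyFun {K : Type*} [Field K] {φ : K → K} :
    φ ∈ polyFun K ↔ ∃ P : Polynomial K, ∀ t, φ t = P.eval t := by
  have h : ∀ (P : Polynomial K) (t : K), Polynomial.aeval (id : K → K) P t = P.eval t := by
    intro P t
    have := Polynomial.aeval_algHom_apply (Pi.evalAlgHom K (fun _ : K => K) t) id P
    exact this.symm.trans (by simp)
  constructor
  · rintro ⟨P, rfl⟩
    exact ⟨P, fun t => h P t⟩
  · rintro ⟨P, hP⟩
    exact ⟨P, funext fun t => (h P t).trans (hP t).symm⟩

theorem id_mem_polyFun {K : Type*} [Field K] : (fun t : K => t) ∈ polyFun K :=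
  mem_polyFun.mpr ⟨Polynomial.X, by simp⟩

theorem const_mem_polyFun {K : Type*} [Field K] (a : K) : (fun _ : K => a) ∈ polyFun K :=
  mem_polyFun.mpr ⟨Polynomial.C a, by simp⟩

/-- The density principle behind all limit arguments: it is applied to the natural numbers, to pass
from powers to one-parameter groups, and to t ≠ 0, to reach t = 0. -/
theorem eq_zero_of_mem_polyFun {K : Type*} [Field K] {φ : K → K} (hφ : φ ∈ polyFun K)
    {s : Set K} (hs : s.Infinite) (h : ∀ t ∈ s, φ t = 0) (t : K) : φ t = 0 := by
  obtain ⟨P, hP⟩ := mem_polyFun.mp hφ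
  have : P = 0 := P.eq_zero_of_infinite_isRoot (hs.mono fun t ht => by
    rw [Set.mem_ofPred_eq, Polynomial.IsRoot, ← hP]
    exact h t ht)
  rw [hP, this, Polynomial.eval_zero]

theorem infinite_ne_zero (K : Type*) [Field K] [CharZero K] : {t : K | t ≠ 0}.Infinite :=
  (Set.finite_singleton (0 : K)).infinite_compl

theorem infinite_range_natCast (K : Type*) [Field K] [CharZero K] :
    (Set.range (Nat.cast : ℕ → K)).Infinite :=
  Set.infinite_range_of_injective Nat.cast_injective

theorem eq_mul_of_additive_of_mem_polyFun {K : Type*} [Field K] [CharZero K] {φ : K → K}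
    (hφ : φ ∈ polyFun K) (h : ∀ s t, φ (s + t) = φ s + φ t) (t : K) : φ t = t * φ 1 := by
  have h1 : (fun t => φ t - t * φ 1) ∈ polyFun K :=
    (polyFun K).sub_mem hφ ((polyFun K).mul_mem id_mem_polyFun (const_mem_polyFun _))
  refine sub_eq_zero.mp (eq_zero_of_mem_polyFun h1 (infinite_range_natCast K) ?_ t)
  rintro _ ⟨k, rfl⟩
  have h0 : φ 0 = 0 := by simpa using h 0 0
  have : ∀ k : ℕ, φ k = k * φ 1 := by
    intro k
    induction k with
    | zero => simp [h0]
    | succ k ih => rw [Nat.cast_succ, h, ih]; ring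
  exact sub_eq_zero.mpr (this k)

theorem eval_mem_polyFun {K σ : Type*} [Field K] (p : MvPolynomial σ K) {c : K → σ → K}
    (hc : ∀ s, (fun t => c t s) ∈ polyFun K) :
    (fun t => MvPolynomial.eval (c t) p) ∈ polyFun K := by
  induction p using MvPolynomial.induction_on with
  | C a => simpa using const_mem_polyFun a
  | add p q hp hq => simp only [map_add]; exact (polyFun K).add_mem hp hq
  | mul_X p s hp => simp only [map_mul, MvPolynomial.eval_X]; exact (polyFun K).mul_mem hp (hc s)

/-! ### Exponentials and the adjoint action in H -/

/-- The product of the matrix algebras, in which `GLProd K m` is the group of units. -/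
abbrev MatProd (K : Type*) [Field K] {k : ℕ} (m : Fin k → ℕ) : Type _ :=
  (i : Fin k) → Matrix (Fin (m i)) (Fin (m i)) K

section MatProd

variable {K : Type*} [Field K] {k : ℕ} {m : Fin k → ℕ}

/-- The inclusion of `GLProd K m` in the product of the matrix algebras. -/
def GLProd.val : GLProd K m →* MatProd K m where
  toFun g i := (g i).1
  map_one' := rfl
  map_mul' _ _ := rfl

theorem GLProd.val_injective : Function.Injective (GLProd.val (K := K) (m := m)) := by
  intro g h hgh
  funext i
  exact Units.ext (congrFun hgh i)

theorem GLProd.inv_val_mul (g : GLProd K m) : GLProd.val g⁻¹ * GLProd.val g = 1 := by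
  rw [← map_mul, inv_mul_cancel, map_one]

theorem GLProd.val_mul_inv (g : GLProd K m) : GLProd.val g * GLProd.val g⁻¹ = 1 := by
  rw [← map_mul, mul_inv_cancel, map_one]

/-- The entries of an element of the product of the matrix algebras. -/
def MatProd.coord (a : MatProd K m) : (Σ i : Fin k, Fin (m i) × Fin (m i)) → K :=
  fun s => a s.1 s.2.1 s.2.2

/-- Cayley–Hamilton: the characteristic polynomial is X ^ n, because its difference from X ^ n is
nilpotent in a reduced ring. -/
theorem Matrix.pow_card_eq_zero_of_isNilpotent {n : ℕ} {N : Matrix (Fin n) (Fin n) K}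
    (hN : IsNilpotent N) : N ^ n = 0 := by
  have h := (Matrix.isNilpotent_charpoly_sub_pow_of_isNilpotent hN).eq_zero
  have h1 := Matrix.aeval_self_charpoly N
  rw [sub_eq_zero.mp h] at h1
  simpa using h1

theorem MatProd.pow_eq_zero_of_isNilpotent {N : MatProd K m} (hN : ∀ i, IsNilpotent (N i)) :
    N ^ ((∑ i, m i) + 2) = 0 := by
  funext i
  have h : m i ≤ ∑ i, m i := Finset.single_le_sum (fun _ _ => Nat.zero_le _) (Finset.mem_univ i)
  exact pow_eq_zero_of_le (by omega) (Matrix.pow_card_eq_zero_of_isNilpotent (hN i))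

theorem MatProd.pow_eq_zero {N : MatProd K m} (hN : IsNilpotent N) :
    N ^ ((∑ i, m i) + 2) = 0 :=
  MatProd.pow_eq_zero_of_isNilpotent fun i => hN.map (Pi.evalRingHom _ i)

/-- The exponential of a nilpotent element. -/
noncomputable def MatProd.ex (N : MatProd K m) : MatProd K m :=
  truncExp K (∑ i, m i) N

/-- The functions from `K` to the product of the matrix algebras whose entries are polynomials. -/
noncomputable def polyCurve (K : Type*) [Field K] {k : ℕ} (m : Fin k → ℕ) :
    Subalgebra K (K → MatProd K m) where
  carrier := {c | ∀ i r s, (fun t => c t i r s) ∈ polyFun K}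
  mul_mem' := by
    intro a b ha hb i r s
    have : (fun t => (a * b) t i r s) =
        ∑ q, (fun t => a t i r q) * (fun t => b t i q s) := by
      funext t
      simp [Matrix.mul_apply]
    rw [this]
    exact (polyFun K).sum_mem fun q _ => (polyFun K).mul_mem (ha i r q) (hb i q s)
  add_mem' ha hb i r s := (polyFun K).add_mem (ha i r s) (hb i r s)
  algebraMap_mem' a i r s := const_mem_polyFun _

theorem isNilpotent_conj {A : Type*} [Ring A] {N g h : A} (hgh : h * g = 1) (hhg : g * h = 1)
    (hN : IsNilpotent N) : IsNilpotent (g * N * h) := by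
  obtain ⟨d, hd⟩ := hN
  refine ⟨d, ?_⟩
  rw [conj_pow_of_mul_eq_one hgh hhg, hd, mul_zero, zero_mul]

/-- The adjoint action of `H`. -/
def GLProd.ad (g : GLProd K m) : MatProd K m →ₗ[K] MatProd K m where
  toFun N := GLProd.val g * N * GLProd.val g⁻¹
  map_add' M N := by rw [mul_add, add_mul]
  map_smul' t N := by rw [mul_smul_comm, smul_mul_assoc, RingHom.id_apply]

theorem GLProd.ad_apply (g : GLProd K m) (N : MatProd K m) :
    GLProd.ad g N = GLProd.val g * N * GLProd.val g⁻¹ := rfl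

theorem GLProd.ad_mul (g h : GLProd K m) (N : MatProd K m) :
    GLProd.ad (g * h) N = GLProd.ad g (GLProd.ad h N) := by
  simp only [GLProd.ad_apply, mul_inv_rev, map_mul, mul_assoc]

theorem GLProd.ad_one (N : MatProd K m) : GLProd.ad 1 N = N := by
  simp [GLProd.ad_apply]

theorem GLProd.isNilpotent_ad (g : GLProd K m) {N : MatProd K m} (hN : IsNilpotent N) :
    IsNilpotent (GLProd.ad g N) :=
  isNilpotent_conj g.inv_val_mul g.val_mul_inv hN

variable [CharZero K]

theorem MatProd.exists_val_eq_ex {N : MatProd K m} (hN : IsNilpotent N) :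
    ∃ g : GLProd K m, GLProd.val g = MatProd.ex N := by
  have h1 := truncExp_add_smul (∑ i, m i) (MatProd.pow_eq_zero hN) (1 : K) (-1)
  have h2 := truncExp_add_smul (∑ i, m i) (MatProd.pow_eq_zero hN) (-1 : K) 1
  rw [add_neg_cancel, zero_smul, truncExp_zero, one_smul] at h1
  rw [neg_add_cancel, zero_smul, truncExp_zero, one_smul] at h2
  exact ⟨fun i => ⟨_, _, (congrFun h1 i).symm, (congrFun h2 i).symm⟩, rfl⟩

open Classical in
/-- The exponential of a nilpotent element, as a point of `H`. -/
noncomputable def GLProd.exp (N : MatProd K m) : GLProd K m :=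
  -- The value `1` off the nilpotent elements is a default; hence `IsLie` asks for nilpotency
  -- separately.
  if hN : IsNilpotent N then (MatProd.exists_val_eq_ex hN).choose else 1

theorem GLProd.val_exp {N : MatProd K m} (hN : IsNilpotent N) :
    GLProd.val (GLProd.exp N) = MatProd.ex N := by
  rw [GLProd.exp, dif_pos hN]
  exact (MatProd.exists_val_eq_ex hN).choose_spec

theorem GLProd.exp_zero : GLProd.exp (0 : MatProd K m) = 1 := by
  refine GLProd.val_injective ?_
  rw [GLProd.val_exp IsNilpotent.zero, MatProd.ex, truncExp_zero, map_one]

theorem GLProd.exp_add_smul {N : MatProd K m} (hN : IsNilpotent N) (s t : K) :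
    GLProd.exp ((s + t) • N) = GLProd.exp (s • N) * GLProd.exp (t • N) := by
  refine GLProd.val_injective ?_
  rw [map_mul, GLProd.val_exp (hN.smul _), GLProd.val_exp (hN.smul _), GLProd.val_exp (hN.smul _)]
  exact truncExp_add_smul _ (MatProd.pow_eq_zero hN) s t

theorem GLProd.exp_neg_smul {N : MatProd K m} (hN : IsNilpotent N) (t : K) :
    GLProd.exp ((-t) • N) = (GLProd.exp (t • N))⁻¹ := by
  rw [eq_inv_iff_mul_eq_one, ← GLProd.exp_add_smul hN, neg_add_cancel, zero_smul, GLProd.exp_zero]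

theorem GLProd.val_exp_smul {N : MatProd K m} (hN : IsNilpotent N) (t : K) :
    GLProd.val (GLProd.exp (t • N)) = 1 + t • expQuot (∑ i, m i) t N := by
  rw [GLProd.val_exp (hN.smul t), MatProd.ex, truncExp_smul]

theorem GLProd.val_exp_smul_inv {N : MatProd K m} (hN : IsNilpotent N) (t : K) :
    GLProd.val (GLProd.exp (t • N))⁻¹ = 1 + t • expQuot (∑ i, m i) t (-N) := by
  rw [← GLProd.exp_neg_smul hN, neg_smul, ← smul_neg, GLProd.val_exp_smul hN.neg]

theorem GLProd.exp_ad (g : GLProd K m) {N : MatProd K m} (hN : IsNilpotent N) :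
    GLProd.exp (GLProd.ad g N) = g * GLProd.exp N * g⁻¹ := by
  refine GLProd.val_injective ?_
  rw [GLProd.val_exp (GLProd.isNilpotent_ad g hN), map_mul, map_mul, GLProd.val_exp hN]
  exact truncExp_conj _ _ g.inv_val_mul g.val_mul_inv

end MatProd

/-! ### Polynomial curves in H and the values of AFs on them -/

section PolyCurve

variable {K : Type*} [Field K] {k : ℕ} {m : Fin k → ℕ}

theorem const_mem_polyCurve (a : MatProd K m) : (fun _ : K => a) ∈ polyCurve K m :=
  fun _ _ _ => const_mem_polyFun _

theorem smul_mem_polyCurve {φ : K → K} (hφ : φ ∈ polyFun K) {c : K → MatProd K m}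
    (hc : c ∈ polyCurve K m) : (fun t => φ t • c t) ∈ polyCurve K m :=
  fun i r s => (polyFun K).mul_mem hφ (hc i r s)

theorem smul_const_mem_polyCurve (N : MatProd K m) : (fun t : K => t • N) ∈ polyCurve K m :=
  smul_mem_polyCurve id_mem_polyFun (const_mem_polyCurve N)

theorem pow_id_mem_polyFun (j : ℕ) : (fun t : K => t ^ j) ∈ polyFun K :=
  (polyFun K).pow_mem id_mem_polyFun j

theorem expQuot_mem_polyCurve (d : ℕ) (N : MatProd K m) :
    (fun t : K => expQuot d t N) ∈ polyCurve K m := by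
  have : (fun t : K => expQuot d t N) = ∑ j ∈ Finset.range (d + 1),
      fun t : K => ((((j + 1).factorial : K)⁻¹ * t ^ j) • N ^ (j + 1)) := by
    funext t
    rw [Finset.sum_apply]
    rfl
  rw [this]
  exact (polyCurve K m).sum_mem fun j _ => smul_mem_polyCurve
    ((polyFun K).mul_mem (const_mem_polyFun _) (pow_id_mem_polyFun j)) (const_mem_polyCurve _)

theorem logQuot_mem_polyCurve (d : ℕ) {M : K → MatProd K m} (hM : M ∈ polyCurve K m) :
    (fun t : K => logQuot d t (M t)) ∈ polyCurve K m := by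
  have : (fun t : K => logQuot d t (M t)) = ∑ j ∈ Finset.range (d + 1),
      fun t : K => (((-1) ^ j * ((j + 1 : ℕ) : K)⁻¹) * t ^ j) • (M ^ (j + 1)) t := by
    funext t
    rw [Finset.sum_apply]
    rfl
  rw [this]
  exact (polyCurve K m).sum_mem fun j _ => smul_mem_polyCurve
    ((polyFun K).mul_mem (const_mem_polyFun _) (pow_id_mem_polyFun j))
    ((polyCurve K m).pow_mem hM _)

theorem ex_mem_polyCurve {N : K → MatProd K m} (hN : N ∈ polyCurve K m) :
    (fun t : K => MatProd.ex (N t)) ∈ polyCurve K m := by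
  have : (fun t : K => MatProd.ex (N t)) = ∑ j ∈ Finset.range ((∑ i, m i) + 2),
      (j.factorial : K)⁻¹ • N ^ j := by
    funext t
    rw [Finset.sum_apply]
    rfl
  rw [this]
  exact (polyCurve K m).sum_mem fun j _ =>
    (polyCurve K m).smul_mem ((polyCurve K m).pow_mem hN j) _

theorem eq_zero_of_mem_polyCurve {c : K → MatProd K m} (hc : c ∈ polyCurve K m) {s : Set K}
    (hs : s.Infinite) (h : ∀ t ∈ s, c t = 0) (t : K) : c t = 0 := by
  funext i
  ext r q
  exact eq_zero_of_mem_polyFun (hc i r q) hs (fun t ht => by rw [h t ht]; rfl) t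

theorem eval_coord_mem_polyFun (p : MvPolynomial (Σ i : Fin k, Fin (m i) × Fin (m i)) K)
    {c : K → MatProd K m} (hc : c ∈ polyCurve K m) :
    (fun t => MvPolynomial.eval (c t).coord p) ∈ polyFun K :=
  eval_mem_polyFun p fun s => hc s.1 s.2.1 s.2.2

theorem AF.mem_dom_of_mem_polyCurve (F : AF K m) {u : K → GLProd K m}
    (hu : (fun t => GLProd.val (u t)) ∈ polyCurve K m) {s : Set K} (hs : s.Infinite)
    (h : ∀ t ∈ s, u t ∈ F.dom) (t : K) : u t ∈ F.dom := by
  obtain ⟨S, hS⟩ := F.closed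
  rw [hS]
  intro p hp
  exact eq_zero_of_mem_polyFun (eval_coord_mem_polyFun p hu) hs
    (fun t ht => (hS _).mp (h t ht) p hp) t

/-- A polynomial that induces the additive function `F`. -/
noncomputable def AF.poly (F : AF K m) : MvPolynomial (Σ i : Fin k, Fin (m i) × Fin (m i)) K :=
  F.regular.choose

/-- The extension of the additive function `F` by a polynomial. -/
noncomputable def AF.fn (F : AF K m) (u : GLProd K m) : K :=
  MvPolynomial.eval (GLProd.val u).coord F.poly

theorem AF.fn_eq (F : AF K m) {u : GLProd K m} (hu : u ∈ F.dom) : F.fn u = F.toFun ⟨u, hu⟩ :=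
  (F.regular.choose_spec ⟨u, hu⟩).symm

theorem AF.fn_mul (F : AF K m) {u v : GLProd K m} (hu : u ∈ F.dom) (hv : v ∈ F.dom) :
    F.fn (u * v) = F.fn u + F.fn v := by
  rw [F.fn_eq hu, F.fn_eq hv, F.fn_eq (mul_mem hu hv), ← F.map_mul]
  rfl

theorem AF.fn_one (F : AF K m) : F.fn 1 = 0 := by
  simpa using F.fn_mul (one_mem _) (one_mem _)

theorem AF.fn_inv (F : AF K m) {u : GLProd K m} (hu : u ∈ F.dom) : F.fn u⁻¹ = - F.fn u := by
  have := F.fn_mul hu (inv_mem hu)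
  rw [mul_inv_cancel, F.fn_one] at this
  linear_combination -this

theorem AF.fn_conj (F : AF K m) {u v : GLProd K m} (hu : u ∈ F.dom) (hv : v ∈ F.dom) :
    F.fn (u * v * u⁻¹) = F.fn v := by
  rw [F.fn_mul (mul_mem hu hv) (inv_mem hu), F.fn_mul hu hv, F.fn_inv hu]
  ring

theorem AF.fn_mem_polyFun (F : AF K m) {u : K → GLProd K m}
    (hu : (fun t => GLProd.val (u t)) ∈ polyCurve K m) : (fun t => F.fn (u t)) ∈ polyFun K :=
  eval_coord_mem_polyFun _ hu

/-- The trace form. -/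
def traceForm (X : MatProd K m) : MatProd K m →ₗ[K] K where
  toFun N := ∑ i, (X i * N i).trace
  map_add' M N := by simp [mul_add, Finset.sum_add_distrib]
  map_smul' t N := by simp [Finset.mul_sum]

theorem traceForm_ad (g : GLProd K m) (X N : MatProd K m) :
    traceForm X (g.ad N) = traceForm (g⁻¹.ad X) N := by
  change ∑ i, (X i * g.ad N i).trace = ∑ i, ((g⁻¹).ad X i * N i).trace
  refine Finset.sum_congr rfl fun i _ => ?_
  simp only [GLProd.ad_apply, Pi.mul_apply, inv_inv]
  rw [← mul_assoc, ← mul_assoc, Matrix.trace_mul_comm]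
  simp only [mul_assoc]

end PolyCurve

/-! ### The Lie algebra of the domain and the differential of an AF -/

section Lie

variable {K : Type*} [Field K] [CharZero K] {k : ℕ} {m : Fin k → ℕ}

theorem val_exp_mem_polyCurve {N : K → MatProd K m} (hN : N ∈ polyCurve K m)
    (hnil : ∀ t, IsNilpotent (N t)) : (fun t => GLProd.val (GLProd.exp (N t))) ∈ polyCurve K m := by
  simp only [GLProd.val_exp (hnil _)]
  exact ex_mem_polyCurve hN

theorem val_exp_smul_mem_polyCurve {N : MatProd K m} (hN : IsNilpotent N) :
    (fun t : K => GLProd.val (GLProd.exp (t • N))) ∈ polyCurve K m :=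
  val_exp_mem_polyCurve (smul_const_mem_polyCurve N) fun t => hN.smul t

/-- Membership in the Lie algebra of a unipotent subgroup. -/
def IsLie (D : Subgroup (GLProd K m)) (N : MatProd K m) : Prop :=
  IsNilpotent N ∧ GLProd.exp N ∈ D

theorem exp_natCast_smul {N : MatProd K m} (hN : IsNilpotent N) (j : ℕ) :
    GLProd.exp ((j : K) • N) = GLProd.exp N ^ j := by
  induction j with
  | zero => simp [GLProd.exp_zero]
  | succ j ih => rw [Nat.cast_succ, GLProd.exp_add_smul hN, ih, one_smul, pow_succ]

/-- For natural t this is a power of the exponential of N, and the domain is Zariski closed. -/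
theorem AF.exp_smul_mem (F : AF K m) {N : MatProd K m} (hN : IsLie F.dom N) (t : K) :
    GLProd.exp (t • N) ∈ F.dom := by
  refine F.mem_dom_of_mem_polyCurve (val_exp_smul_mem_polyCurve hN.1) (infinite_range_natCast K)
    ?_ t
  rintro _ ⟨j, rfl⟩
  rw [exp_natCast_smul hN.1]
  exact pow_mem hN.2 j

theorem AF.isLie_smul (F : AF K m) {N : MatProd K m} (hN : IsLie F.dom N) (t : K) :
    IsLie F.dom (t • N) :=
  ⟨hN.1.smul t, F.exp_smul_mem hN t⟩

theorem AF.fn_exp_smul (F : AF K m) {N : MatProd K m} (hN : IsLie F.dom N) (t : K) :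
    F.fn (GLProd.exp (t • N)) = t * F.fn (GLProd.exp N) := by
  have := eq_mul_of_additive_of_mem_polyFun
    (F.fn_mem_polyFun (val_exp_smul_mem_polyCurve hN.1)) (fun s t => by
      rw [GLProd.exp_add_smul hN.1, F.fn_mul (F.exp_smul_mem hN s) (F.exp_smul_mem hN t)]) t
  rwa [one_smul] at this

theorem AF.exp_logQuot (F : AF K m) {u : GLProd K m} (hu : u ∈ F.dom) {M : MatProd K m}
    (hM : GLProd.val u = 1 + M) :
    IsNilpotent (logQuot (∑ i, m i) (1 : K) M) ∧
      GLProd.exp (logQuot (∑ i, m i) (1 : K) M) = u := by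
  have h1 : M ^ ((∑ i, m i) + 2) = 0 := by
    refine MatProd.pow_eq_zero_of_isNilpotent fun i => ?_
    have := F.unipotent u hu i
    have h2 : M = GLProd.val u - 1 := by rw [hM, add_sub_cancel_left]
    rw [h2]
    exact this
  have h2 : IsNilpotent (logQuot (∑ i, m i) (1 : K) M) := isNilpotent_logQuot _ ⟨_, h1⟩
  refine ⟨h2, GLProd.val_injective ?_⟩
  rw [GLProd.val_exp h2, MatProd.ex, truncExp_logQuot _ h1, hM]

theorem AF.exists_exp_eq (F : AF K m) {u : GLProd K m} (hu : u ∈ F.dom) :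
    ∃ N, IsLie F.dom N ∧ GLProd.exp N = u := by
  obtain ⟨h1, h2⟩ := F.exp_logQuot hu (M := GLProd.val u - 1) (by rw [add_sub_cancel])
  exact ⟨_, ⟨h1, h2.symm ▸ hu⟩, h2⟩

/-- The derivative at `1` of a polynomial curve in the domain of `F` belongs to the Lie algebra,
and its image under the differential of `F` is determined by the values of `F` on the curve. -/
theorem AF.isLie_of_curve (F : AF K m) {u : K → GLProd K m} (hu : ∀ t, u t ∈ F.dom)
    {M : K → MatProd K m} (hM : M ∈ polyCurve K m) (huM : ∀ t, GLProd.val (u t) = 1 + t • M t) :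
    IsLie F.dom (M 0) ∧ ∀ s, (∀ t, F.fn (u t) = t * s) → F.fn (GLProd.exp (M 0)) = s := by
  -- L(t) is log(u(t)) / t, made polynomial so that it makes sense at t = 0, where it equals M(0).
  -- For t ≠ 0 it is a rescaled logarithm of a point of the domain; nilpotency, membership and the
  -- value of F then extend to t = 0.
  set L : K → MatProd K m := fun t => logQuot (∑ i, m i) t (M t) with hL
  have hL0 : L 0 = M 0 := logQuot_zero _ _
  have hLc : L ∈ polyCurve K m := logQuot_mem_polyCurve _ hM
  have h1 : ∀ t, IsNilpotent (t • L t) ∧ GLProd.exp (t • L t) = u t := by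
    intro t
    rw [hL, ← logQuot_one_smul]
    exact F.exp_logQuot (hu t) (huM t)
  have h2 : ∀ t, t ≠ 0 → IsLie F.dom (L t) := by
    intro t ht
    have := F.isLie_smul (N := t • L t) ⟨(h1 t).1, (h1 t).2 ▸ hu t⟩ t⁻¹
    rwa [smul_smul, inv_mul_cancel₀ ht, one_smul] at this
  have h3 : ∀ t, IsNilpotent (L t) := by
    intro t
    refine ⟨(∑ i, m i) + 2, ?_⟩
    exact eq_zero_of_mem_polyCurve ((polyCurve K m).pow_mem hLc _) (infinite_ne_zero K)
      (fun t ht => MatProd.pow_eq_zero (h2 t ht).1) t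
  have hc := val_exp_mem_polyCurve hLc h3
  refine ⟨?_, fun s hs => ?_⟩
  · rw [← hL0]
    exact ⟨h3 0, F.mem_dom_of_mem_polyCurve hc (infinite_ne_zero K) (fun t ht => (h2 t ht).2) 0⟩
  · rw [← hL0]
    refine sub_eq_zero.mp (eq_zero_of_mem_polyFun
      ((polyFun K).sub_mem (F.fn_mem_polyFun hc) (const_mem_polyFun s)) (infinite_ne_zero K)
      (fun t ht => ?_) 0)
    have h4 := F.fn_exp_smul (h2 t ht) t
    rw [(h1 t).2, hs] at h4
    exact sub_eq_zero.mpr (mul_left_cancel₀ ht h4).symm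

theorem AF.isLie_of_curve_mul (F : AF K m) {u : K → GLProd K m} (hu : ∀ t, u t ∈ F.dom)
    {M N : K → MatProd K m} (hM : M ∈ polyCurve K m) (hN : N ∈ polyCurve K m)
    (huMN : ∀ t, GLProd.val (u t) = (1 + t • M t) * (1 + t • N t)) :
    IsLie F.dom (M 0 + N 0) ∧
      ∀ s, (∀ t, F.fn (u t) = t * s) → F.fn (GLProd.exp (M 0 + N 0)) = s := by
  have hc : (fun t => M t + N t + t • (M t * N t)) ∈ polyCurve K m :=
    (polyCurve K m).add_mem ((polyCurve K m).add_mem hM hN)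
      (smul_mem_polyCurve id_mem_polyFun ((polyCurve K m).mul_mem hM hN))
  have := F.isLie_of_curve hu hc fun t => by
    rw [huMN, smul_add, smul_add, smul_smul, ← smul_mul_smul_comm]
    simp only [add_mul, mul_add, one_mul, mul_one, smul_mul_smul_comm]
    abel
  simpa only [zero_smul, add_zero] using this

/-- M + N is the derivative at t = 0 of the curve exp(tM) exp(tN), on which F is linear in t; no
Baker–Campbell–Hausdorff formula is needed. -/
theorem AF.isLie_add (F : AF K m) {M N : MatProd K m} (hM : IsLie F.dom M) (hN : IsLie F.dom N) :
    IsLie F.dom (M + N) ∧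
      F.fn (GLProd.exp (M + N)) = F.fn (GLProd.exp M) + F.fn (GLProd.exp N) := by
  have := F.isLie_of_curve_mul (u := fun t => GLProd.exp (t • M) * GLProd.exp (t • N))
    (fun t => mul_mem (F.exp_smul_mem hM t) (F.exp_smul_mem hN t))
    (expQuot_mem_polyCurve (∑ i, m i) M) (expQuot_mem_polyCurve (∑ i, m i) N)
    (fun t => by
      rw [_root_.map_mul, GLProd.val_exp_smul hM.1, GLProd.val_exp_smul hN.1])
  simp only [expQuot_zero] at this
  refine ⟨this.1, this.2 _ fun t => ?_⟩
  rw [F.fn_mul (F.exp_smul_mem hM t) (F.exp_smul_mem hN t), F.fn_exp_smul hM, F.fn_exp_smul hN]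
  ring

/-- The Lie algebra of the domain of `F`. -/
def AF.lie (F : AF K m) : Submodule K (MatProd K m) where
  carrier := {N | IsLie F.dom N}
  zero_mem' := ⟨IsNilpotent.zero, by rw [GLProd.exp_zero]; exact one_mem _⟩
  add_mem' hM hN := (F.isLie_add hM hN).1
  smul_mem' t _ hN := F.isLie_smul hN t

/-- The differential of `F`. -/
noncomputable def AF.diff (F : AF K m) : F.lie →ₗ[K] K where
  toFun N := F.fn (GLProd.exp N.1)
  map_add' M N := (F.isLie_add M.2 N.2).2
  map_smul' t N := F.fn_exp_smul N.2 t

theorem AF.ad_mem_lie (F : AF K m) {x : GLProd K m} (hx : x ∈ F.dom) {N : MatProd K m}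
    (hN : N ∈ F.lie) : x.ad N ∈ F.lie :=
  ⟨x.isNilpotent_ad hN.1, by
    rw [GLProd.exp_ad x hN.1]
    exact mul_mem (mul_mem hx hN.2) (inv_mem hx)⟩

theorem AF.fn_exp_ad (F : AF K m) {x : GLProd K m} (hx : x ∈ F.dom) {N : MatProd K m}
    (hN : N ∈ F.lie) : F.fn (GLProd.exp (x.ad N)) = F.fn (GLProd.exp N) := by
  rw [GLProd.exp_ad x hN.1, F.fn_conj hx hN.2]

/-- `X` represents the differential of `F` with respect to the trace form. -/
def AF.Represents (F : AF K m) (X : MatProd K m) : Prop :=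
  ∀ N ∈ F.lie, traceForm X N = F.fn (GLProd.exp N)

end Lie

/-! ### Commutators in an eu-step -/

section Commutators

variable {K : Type*} [Field K] {k : ℕ} {m : Fin k → ℕ}

theorem GLProd.conj_one_add_smul (x : GLProd K m) (t : K) (N : MatProd K m) :
    GLProd.val x * (1 + t • N) * GLProd.val x⁻¹ = 1 + t • x.ad N := by
  rw [mul_add, mul_one, add_mul, x.val_mul_inv, mul_smul_comm, smul_mul_assoc, x.ad_apply]

variable {F F' : AF K m}

theorem AF.EuStep.fn_eq_fn (h : F.EuStep F') {u : GLProd K m} (hu : u ∈ F.dom) (hu' : u ∈ F'.dom) :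
    F'.fn u = F.fn u := by
  rw [F'.fn_eq hu', F.fn_eq hu, h.1 u hu hu']

theorem AF.EuStep.commutator_mem (h : F.EuStep F') {x y : GLProd K m} (hx : x ∈ F'.dom)
    (hy : y ∈ F.dom) : x * y * x⁻¹ * y⁻¹ ∈ F.dom ⊓ F'.dom := by
  obtain ⟨-, hC, -⟩ := h
  have := inv_mem (hC y hy x hx)
  simpa [mul_assoc] using this

end Commutators

/-! ### Moving representatives backwards along the steps -/

section Steps

variable {K : Type*} [Field K] [CharZero K] {k : ℕ} {m : Fin k → ℕ}

theorem AF.EStep.represents {F F' : AF K m} (h : F.EStep F') {X : MatProd K m}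
    (hX : F'.Represents X) : F.Represents X := by
  intro N hN
  have hN' : N ∈ F'.lie := ⟨hN.1, h.1 hN.2⟩
  rw [hX N hN', F'.fn_eq hN'.2, F.fn_eq hN.2]
  exact h.2.2 _ hN.2 hN'.2

theorem AF.CoStep.exists_represents {F F' : AF K m} (h : F.CoStep F') {X : MatProd K m}
    (hX : F'.Represents X) : ∃ g : GLProd K m, F.Represents (g.ad X) := by
  obtain ⟨γ, hγ, hF⟩ := h
  refine ⟨γ⁻¹, fun N hN => ?_⟩
  have hconj : γ⁻¹ * (γ * GLProd.exp N * γ⁻¹) * γ = GLProd.exp N := by group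
  have hN' : γ.ad N ∈ F'.lie := by
    refine ⟨γ.isNilpotent_ad hN.1, ?_⟩
    rw [hγ, GLProd.exp_ad γ hN.1, hconj]
    exact hN.2
  have hm : γ * GLProd.exp N * γ⁻¹ ∈ F'.dom := GLProd.exp_ad γ hN.1 ▸ hN'.2
  rw [← traceForm_ad, hX _ hN', GLProd.exp_ad γ hN.1, F'.fn_eq hm, F.fn_eq hN.2,
    hF _ hm (hconj.symm ▸ hN.2)]
  congr 1
  exact Subtype.ext hconj

namespace AF

variable {F F' : AF K m}

/-- Ad(x)Y - Y is the derivative at t = 0 of the commutator of x with exp(tY). -/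
theorem ad_sub_mem_lie {G : AF K m} {x : GLProd K m} {Y : MatProd K m} (hY : IsNilpotent Y)
    (h : ∀ t : K, x * GLProd.exp (t • Y) * x⁻¹ * (GLProd.exp (t • Y))⁻¹ ∈ G.dom) :
    x.ad Y - Y ∈ G.lie := by
  have := (G.isLie_of_curve_mul h (M := fun t => x.ad (expQuot (∑ i, m i) t Y))
    (N := fun t => expQuot (∑ i, m i) t (-Y))
    ((polyCurve K m).mul_mem ((polyCurve K m).mul_mem (const_mem_polyCurve _)
      (expQuot_mem_polyCurve _ Y)) (const_mem_polyCurve _))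
    (expQuot_mem_polyCurve _ _) fun t => by
      rw [_root_.map_mul, _root_.map_mul, _root_.map_mul, GLProd.val_exp_smul hY,
        GLProd.val_exp_smul_inv hY, x.conj_one_add_smul]).1
  simp only [expQuot_zero, ← sub_eq_add_neg] at this
  exact this

theorem EuStep.ad_sub_mem (h : F.EuStep F') {x : GLProd K m} (hx : x ∈ F'.dom) {Y : MatProd K m}
    (hY : Y ∈ F.lie) : x.ad Y - Y ∈ F.lie ⊓ F'.lie :=
  ⟨ad_sub_mem_lie hY.1 fun t => (h.commutator_mem hx (F.exp_smul_mem hY t)).1,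
    ad_sub_mem_lie hY.1 fun t => (h.commutator_mem hx (F.exp_smul_mem hY t)).2⟩

/-- The linear functional on the Lie algebra of `F` that an element of the domain of `F'` induces
through the commutator pairing. -/
noncomputable def EuStep.pairing (h : F.EuStep F') {x : GLProd K m} (hx : x ∈ F'.dom) :
    F.lie →ₗ[K] K :=
  F'.diff ∘ₗ LinearMap.codRestrict F'.lie ((x.ad - LinearMap.id) ∘ₗ F.lie.subtype)
    fun Y => (h.ad_sub_mem hx Y.2).2

theorem EuStep.pairing_apply (h : F.EuStep F') {x : GLProd K m} (hx : x ∈ F'.dom) (Y : F.lie) :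
    h.pairing hx Y = F'.fn (GLProd.exp (x.ad Y.1 - Y.1)) := rfl

/-- The cocycle Ad(xz)Y - Y = Ad(x)(Ad(z)Y - Y) + (Ad(x)Y - Y) becomes a homomorphism in x because
the differential of F' is invariant under Ad(x). -/
theorem EuStep.pairing_mul (h : F.EuStep F') {x z : GLProd K m} (hx : x ∈ F'.dom)
    (hz : z ∈ F'.dom) :
    h.pairing (mul_mem hx hz) = h.pairing hx + h.pairing hz := by
  ext Y
  have h1 : (x * z).ad Y.1 - Y.1 = x.ad (z.ad Y.1 - Y.1) + (x.ad Y.1 - Y.1) := by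
    rw [GLProd.ad_mul, map_sub]
    abel
  have h2 := (h.ad_sub_mem hz Y.2).2
  rw [LinearMap.add_apply, h.pairing_apply, h.pairing_apply, h.pairing_apply, h1,
    (F'.isLie_add (F'.ad_mem_lie hx h2) (h.ad_sub_mem hx Y.2).2).2, F'.fn_exp_ad hx h2, add_comm]

/-- The left side is additive and polynomial in t, hence linear. This makes the set of induced
functionals a linear subspace and not merely a subgroup. -/
theorem EuStep.pairing_exp_smul (h : F.EuStep F') {Z : MatProd K m} (hZ : Z ∈ F'.lie) (t : K) :
    h.pairing (F'.exp_smul_mem hZ t) = t • h.pairing hZ.2 := by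
  ext Y
  have hc : (fun t : K => (GLProd.exp (t • Z)).ad Y.1 - Y.1) ∈ polyCurve K m := by
    refine (polyCurve K m).sub_mem ((polyCurve K m).mul_mem ((polyCurve K m).mul_mem
      (val_exp_smul_mem_polyCurve hZ.1) (const_mem_polyCurve _)) ?_) (const_mem_polyCurve _)
    simp only [GLProd.val_exp_smul_inv hZ.1]
    exact (polyCurve K m).add_mem (const_mem_polyCurve _)
      (smul_mem_polyCurve id_mem_polyFun (expQuot_mem_polyCurve _ _))
  have := eq_mul_of_additive_of_mem_polyFun
    (φ := fun t => h.pairing (F'.exp_smul_mem hZ t) Y)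
    (F'.fn_mem_polyFun (val_exp_mem_polyCurve hc
      fun t => (h.ad_sub_mem (F'.exp_smul_mem hZ t) Y.2).1.1)) (fun s t => by
      have := h.pairing_mul (F'.exp_smul_mem hZ s) (F'.exp_smul_mem hZ t)
      simp only [← GLProd.exp_add_smul hZ.1] at this
      rw [this, LinearMap.add_apply]) t
  simp only [one_smul] at this
  exact this

/-- The space of the linear functionals induced by the elements of the domain of `F'`. -/
noncomputable def EuStep.pairingSpace (h : F.EuStep F') : Submodule K (Module.Dual K F.lie) where
  carrier := {φ | ∃ (x : GLProd K m) (hx : x ∈ F'.dom), φ = h.pairing hx}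
  zero_mem' := by
    refine ⟨1, one_mem _, ?_⟩
    have := h.pairing_mul (one_mem _) (one_mem _)
    simp only [mul_one] at this
    exact (left_eq_add.mp this).symm
  add_mem' := by
    rintro _ _ ⟨x, hx, rfl⟩ ⟨z, hz, rfl⟩
    exact ⟨x * z, mul_mem hx hz, (h.pairing_mul hx hz).symm⟩
  smul_mem' := by
    rintro t _ ⟨x, hx, rfl⟩
    obtain ⟨Z, hZ, rfl⟩ := F'.exists_exp_eq hx
    exact ⟨_, F'.exp_smul_mem hZ t, (h.pairing_exp_smul hZ t).symm⟩

/-- Translates the group-level pairing in the definition of an eu-step into its infinitesimal form.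
Along exp(tY) the value of F on the commutator is linear in t, so it is read off from the derivative
Y - Ad(x)Y at t = 0. -/
theorem EuStep.fn_commutator_exp (h : F.EuStep F') {x : GLProd K m} (hx : x ∈ F'.dom) (Y : F.lie) :
    F.fn (GLProd.exp Y.1 * x * (GLProd.exp Y.1)⁻¹ * x⁻¹) = - h.pairing hx Y := by
  have hYt := F.exp_smul_mem Y.2
  set u : K → GLProd K m := fun t => GLProd.exp (t • Y.1) * x * (GLProd.exp (t • Y.1))⁻¹ * x⁻¹
    with hu
  have hmem : ∀ t, u t ∈ F.dom := fun t => by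
    have := F.dom.inv_mem (h.commutator_mem hx (hYt t)).1
    simpa [hu, mul_assoc] using this
  have hM := expQuot_mem_polyCurve (K := K) (∑ i, m i) Y.1
  have hN : (fun t : K => x.ad (expQuot (∑ i, m i) t (-Y.1))) ∈ polyCurve K m :=
    (polyCurve K m).mul_mem ((polyCurve K m).mul_mem (const_mem_polyCurve _)
      (expQuot_mem_polyCurve _ _)) (const_mem_polyCurve _)
  have hval : ∀ t, GLProd.val (u t) = (1 + t • expQuot (∑ i, m i) t Y.1) *
      (1 + t • x.ad (expQuot (∑ i, m i) t (-Y.1))) := by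
    intro t
    rw [hu]
    simp only [_root_.map_mul]
    rw [GLProd.val_exp_smul Y.2.1, GLProd.val_exp_smul_inv Y.2.1, mul_assoc, mul_assoc,
      ← mul_assoc (GLProd.val x), x.conj_one_add_smul]
  have hcurve : (fun t => GLProd.val (u t)) ∈ polyCurve K m := by
    simp only [hval]
    have h1 := (polyCurve K m).one_mem
    exact (polyCurve K m).mul_mem
      ((polyCurve K m).add_mem h1 (smul_mem_polyCurve id_mem_polyFun hM))
      ((polyCurve K m).add_mem h1 (smul_mem_polyCurve id_mem_polyFun hN))
  have hadd : ∀ s t, F.fn (u (s + t)) = F.fn (u s) + F.fn (u t) := by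
    intro s t
    -- The commutator identity [ab, x] = a[b, x]a⁻¹ · [a, x]; F ignores the conjugation by a.
    have : u (s + t) = GLProd.exp (s • Y.1) * u t * (GLProd.exp (s • Y.1))⁻¹ * u s := by
      simp only [hu, GLProd.exp_add_smul Y.2.1]
      group
    rw [this, F.fn_mul (mul_mem (mul_mem (hYt s) (hmem t)) (inv_mem (hYt s))) (hmem s),
      F.fn_conj (hYt s) (hmem t), add_comm]
  have h1 := (F.isLie_of_curve_mul hmem hM hN hval).2 (F.fn (u 1)) fun t =>
    eq_mul_of_additive_of_mem_polyFun (F.fn_mem_polyFun hcurve) hadd t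
  simp only [expQuot_zero] at h1
  have h2 : GLProd.exp Y.1 * x * (GLProd.exp Y.1)⁻¹ * x⁻¹ = u 1 := by simp only [hu, one_smul]
  have h3 := h.ad_sub_mem hx Y.2
  have h4 : Y.1 + x.ad (-Y.1) = (-1 : K) • (x.ad Y.1 - Y.1) := by
    rw [map_neg, neg_one_smul]
    abel
  rw [h2, ← h1, h4, F.fn_exp_smul h3.1, h.pairing_apply, h.fn_eq_fn h3.1.2 h3.2.2, neg_one_mul]

theorem EuStep.mem_of_pairing_eq_zero (h : F.EuStep F') (Y : F.lie)
    (hY : ∀ (x : GLProd K m) (hx : x ∈ F'.dom), h.pairing hx Y = 0) : Y.1 ∈ F'.lie := by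
  refine ⟨Y.2.1, ?_⟩
  obtain ⟨hC, h1, -⟩ := h.2
  refine h1 _ Y.2.2 fun x hx => ?_
  rw [← F.fn_eq, h.fn_commutator_exp hx, hY x hx, neg_zero]

/-- The failure of X to represent F is a functional that the pairing with some x in the domain of F'
produces, and conjugating X by x⁻¹ corrects it. -/
theorem EuStep.exists_represents (h : F.EuStep F') {X : MatProd K m} (hX : F'.Represents X) :
    ∃ g : GLProd K m, F.Represents (g.ad X) := by
  set φ : Module.Dual K F.lie := F.diff - traceForm X ∘ₗ F.lie.subtype with hφ
  have hmem : φ ∈ h.pairingSpace := by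
    -- By finite-dimensional duality it suffices that φ vanishes on the common kernel of the induced
    -- functionals. By nondegeneracy this kernel lies in the Lie algebra of F', where both terms of
    -- φ equal the differential of F'.
    rw [← Subspace.dualCoannihilator_dualAnnihilator_eq (W := h.pairingSpace),
      Submodule.mem_dualAnnihilator]
    intro Y hY
    rw [Submodule.mem_dualCoannihilator] at hY
    have hY' := h.mem_of_pairing_eq_zero Y fun x hx => hY _ ⟨x, hx, rfl⟩
    change F.fn (GLProd.exp Y.1) - traceForm X Y.1 = 0
    rw [hX _ hY', h.fn_eq_fn Y.2.2 hY'.2, sub_self]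
  obtain ⟨x, hx, hφx⟩ := hmem
  refine ⟨x⁻¹, fun Y hY => ?_⟩
  have h1 := LinearMap.congr_fun hφx ⟨Y, hY⟩
  change F.fn (GLProd.exp Y) - traceForm X Y = F'.fn (GLProd.exp (x.ad Y - Y)) at h1
  rw [← hX _ (h.ad_sub_mem hx hY).2, map_sub, traceForm_ad] at h1
  linear_combination -h1

theorem HasPath.exists_represents (h : F.HasPath F') {X : MatProd K m} (hX : F'.Represents X) :
    ∃ g : GLProd K m, F.Represents (g.ad X) := by
  induction h using Relation.ReflTransGen.head_induction_on with
  | refl => exact ⟨1, by rwa [GLProd.ad_one]⟩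
  | head hstep _ ih =>
    obtain ⟨g, hg⟩ := ih
    rcases hstep with hs | hs | hs
    · exact ⟨g, hs.represents hg⟩
    · obtain ⟨g', hg'⟩ := hs.exists_represents hg
      exact ⟨g' * g, by rwa [GLProd.ad_mul]⟩
    · obtain ⟨g', hg'⟩ := hs.exists_represents hg
      exact ⟨g' * g, by rwa [GLProd.ad_mul]⟩

end AF

end Steps

/-! ### Ranks of Jordan matrices and of subdiagonal matrices -/

section Rank

open Matrix

theorem Matrix.rank_add_le {K ι κ : Type*} [Field K] [Fintype ι] [Fintype κ]
    (A B : Matrix ι κ K) : (A + B).rank ≤ A.rank + B.rank := by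
  simp only [Matrix.rank]
  refine (Submodule.finrank_mono ?_).trans (Submodule.finrank_add_le_finrank_add_finrank _ _)
  rw [Matrix.mulVecLin_add]
  exact LinearMap.range_add_le _ _

theorem Matrix.rank_sum_le {K ι κ α : Type*} [Field K] [Fintype ι] [Fintype κ] (s : Finset α)
    (A : α → Matrix ι κ K) : (∑ i ∈ s, A i).rank ≤ ∑ i ∈ s, (A i).rank := by
  classical
  induction s using Finset.induction_on with
  | empty => simp
  | insert i s hi ih =>
    rw [Finset.sum_insert hi, Finset.sum_insert hi]
    exact (Matrix.rank_add_le _ _).trans (Nat.add_le_add_left ih _)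

theorem rank_nilJordanMatrix {K : Type*} [Field K] {n : ℕ} (p : Nat.Partition n) :
    (nilJordanMatrix K p).rank = (p.parts.map fun t => t - 1).sum := by
  set l := p.parts.toList with hl
  have hcard : Fintype.card (Σ t : Fin l.length, Fin (l.get t - 1)) =
      (p.parts.map fun t => t - 1).sum := by
    rw [Fintype.card_sigma]
    simp only [Fintype.card_fin]
    rw [← Multiset.coe_toList p.parts, Multiset.map_coe, Multiset.sum_coe, ← hl,
      ← List.ofFn_getElem (xs := l.map _), List.sum_ofFn]
    refine Fintype.sum_equiv (finCongr (by simp)) _ _ fun t => by simp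
  rw [← hcard]
  -- `f` selects all rows but the last of each block and `g` all columns but the first. The other
  -- rows vanish, and the selected minor is the identity.
  let f : (Σ t : Fin l.length, Fin (l.get t - 1)) → Σ t : Fin l.length, Fin (l.get t) :=
    fun s => ⟨s.1, ⟨s.2, by omega⟩⟩
  let g : (Σ t : Fin l.length, Fin (l.get t - 1)) → Σ t : Fin l.length, Fin (l.get t) :=
    fun s => ⟨s.1, ⟨s.2 + 1, by omega⟩⟩
  have hf : Function.Injective f := by
    rintro ⟨t, r⟩ ⟨t', r'⟩ h
    simp only [f, Sigma.mk.injEq] at h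
    obtain ⟨rfl, h⟩ := h
    simp only [heq_eq_eq, Fin.mk.injEq] at h
    rw [Fin.ext h]
  refine le_antisymm ?_ ?_
  · refine (rank_le_card_of_support_subset _ (Finset.univ.map ⟨f, hf⟩) ?_).trans (by simp)
    rintro ⟨t, r⟩ hr
    by_contra hne
    refine hr (funext fun ⟨t', c⟩ => ?_)
    change nilJordanMatrix K p ⟨t, r⟩ ⟨t', c⟩ = 0
    rw [nilJordanMatrix, blockDiagonal'_apply]
    split_ifs with htt
    · obtain rfl : t = t' := htt
      simp only [cast_eq, nilJordanBlock, of_apply]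
      refine if_neg fun hrc => hne ?_
      have hc : (c : ℕ) < l.get t := c.2
      simp only [Finset.coe_map, Finset.coe_univ, Set.image_univ, Set.mem_range]
      exact ⟨⟨t, ⟨r, by omega⟩⟩, rfl⟩
    · rfl
  · have h1 : (nilJordanMatrix K p).submatrix f g = 1 := by
      ext ⟨t, r⟩ ⟨t', r'⟩
      rw [submatrix_apply, nilJordanMatrix, blockDiagonal'_apply]
      split_ifs with htt
      · obtain rfl : t = t' := htt
        simp [f, g, nilJordanBlock, one_apply, Fin.ext_iff]
      · rw [one_apply_ne]
        rintro h
        exact htt (by cases h; rfl)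
    have h2 := rank_submatrix_le (nilJordanMatrix K p) f g
    rwa [h1, rank_one] at h2

theorem rank_conj_units {K : Type*} [Field K] {n : ℕ} (g : GL (Fin n) K)
    (A : Matrix (Fin n) (Fin n) K) : (g.1 * A * (g⁻¹ : GL (Fin n) K).1).rank = A.rank := by
  rw [rank_mul_eq_left_of_isUnit_det _ _ ((isUnit_iff_isUnit_det _).mp (g⁻¹).isUnit),
    rank_mul_eq_right_of_isUnit_det _ _ ((isUnit_iff_isUnit_det _).mp g.isUnit)]

theorem HasJordanType.rank_eq {K : Type*} [Field K] {n : ℕ} {A : Matrix (Fin n) (Fin n) K}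
    {p : Nat.Partition n} (h : HasJordanType A p) :
    A.rank = (p.parts.map fun t => t - 1).sum := by
  obtain ⟨e, g, rfl⟩ := h
  rw [rank_conj_units, rank_reindex, rank_nilJordanMatrix]

/-- A matrix supported on the subdiagonal has minimal rank among the matrices with the same
entries below the diagonal. -/
theorem Matrix.rank_le_rank_of_subdiagonal {K : Type*} [Field K] {n : ℕ}
    {J T : Matrix (Fin n) (Fin n) K} (hJ : ∀ c r, J c r ≠ 0 → (c : ℕ) = r + 1)
    (hT : ∀ r c, r < c → T c r = J c r) : J.rank ≤ T.rank := by
  classical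
  let s : Finset (Fin n) := Finset.univ.filter fun c => ∃ r, J c r ≠ 0
  refine (rank_le_card_of_support_subset J s ?_).trans ?_
  · intro c hc
    obtain ⟨r, hr⟩ := Function.ne_iff.mp hc
    simpa [s] using ⟨r, hr⟩
  · have hs : ∀ c : s, ∃ r, J c.1 r ≠ 0 := fun c => (Finset.mem_filter.mp c.2).2
    choose f hf using hs
    have hval : ∀ c : s, (c.1 : ℕ) = f c + 1 := fun c => hJ _ _ (hf c)
    -- The minor has the nonzero rows c of J and the columns c - 1. Its entries on and below its
    -- diagonal lie strictly below the diagonal of T, so they are entries of J: nonzero on the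
    -- diagonal, zero below it.
    have htri : (T.submatrix (fun c : s => c.1) f).IsUpperTriangular := by
      intro c c' h
      have h' : c'.1 < c.1 := h
      have h1 := hval c'
      rw [Fin.lt_def] at h'
      rw [submatrix_apply, hT _ _ (by rw [Fin.lt_def]; omega)]
      by_contra hne
      have := hJ _ _ hne
      omega
    have hdet : (T.submatrix (fun c : s => c.1) f).det ≠ 0 := by
      rw [det_of_isUpperTriangular htri, Finset.prod_ne_zero_iff]
      intro c _
      have h1 := hval c
      rw [submatrix_apply, hT _ _ (by rw [Fin.lt_def]; omega)]
      exact hf c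
    have h1 := rank_of_det_ne_zero hdet
    rw [Fintype.card_coe] at h1
    rw [← h1]
    exact rank_submatrix_le _ _ _

end Rank

/-! ### The matrix J_F represents F -/

section Representation

variable {K : Type*} [Field K] {k : ℕ} {m : Fin k → ℕ}

theorem AF.IsJ.traceForm_eq {F : AF K m} {J : MatProd K m} (h : F.IsJ J) {u : GLProd K m}
    (hu : u ∈ F.dom) : traceForm J (GLProd.val u) = F.fn u :=
  (h.1 u hu).trans (F.fn_eq hu).symm

theorem AF.IsJ.traceForm_one {F : AF K m} {J : MatProd K m} (h : F.IsJ J) :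
    traceForm J 1 = 0 := by
  rw [← map_one GLProd.val, h.traceForm_eq (one_mem _), F.fn_one]

theorem traceForm_mem_polyFun (X : MatProd K m) {c : K → MatProd K m} (hc : c ∈ polyCurve K m) :
    (fun t => traceForm X (c t)) ∈ polyFun K := by
  have h : (fun t => X * c t) ∈ polyCurve K m :=
    (polyCurve K m).mul_mem (const_mem_polyCurve X) hc
  have : (fun t => traceForm X (c t)) = ∑ i, ∑ r, fun t => (X * c t) i r r := by
    funext t
    simp only [Finset.sum_apply]
    rfl
  rw [this]
  exact (polyFun K).sum_mem fun i _ => (polyFun K).sum_mem fun r _ => h i r r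

variable [CharZero K]

/-- The defining identity of J at exp(tN) has zero constant term; dividing it by t and setting t = 0
leaves the linear term tr(JN). -/
theorem AF.IsJ.represents {F : AF K m} {J : MatProd K m} (h : F.IsJ J) : F.Represents J := by
  intro N hN
  have h1 : (fun t : K => traceForm J (expQuot (∑ i, m i) t N) - F.fn (GLProd.exp N)) ∈
      polyFun K :=
    (polyFun K).sub_mem (traceForm_mem_polyFun J (expQuot_mem_polyCurve _ N)) (const_mem_polyFun _)
  have h2 := eq_zero_of_mem_polyFun h1 (infinite_ne_zero K) (fun t ht => ?_) 0
  · rwa [expQuot_zero, sub_eq_zero] at h2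
  · have h3 := h.traceForm_eq (F.exp_smul_mem hN t)
    rw [F.fn_exp_smul hN, GLProd.val_exp_smul hN.1, map_add, h.traceForm_one, zero_add, map_smul,
      smul_eq_mul] at h3
    exact sub_eq_zero.mpr (mul_left_cancel₀ ht h3)

end Representation

/-! ### AFs on U_n and their diagonal images -/

section Diagonal

open Matrix

variable {K : Type*} [Field K] {n : ℕ}

theorem one_add_single_mul {ι : Type*} [Fintype ι] [DecidableEq ι] {r c : ι} (h : r ≠ c) (s t : K) :
    (1 + single r c s : Matrix ι ι K) * (1 + single r c t) = 1 + single r c (s + t) := by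
  have h0 : (single r c s : Matrix ι ι K) * single r c t = 0 :=
    single_mul_single_of_ne s r c r h.symm t
  rw [add_mul, mul_add, one_mul, one_mul, mul_add, mul_one, h0, single_add]
  abel

/-- The elements of the root groups of `GL_n`. -/
def rootElement (r c : Fin n) (h : r < c) (t : K) : GLProd K (fun _ : Fin 1 => n) := fun _ =>
  ⟨1 + single r c t, 1 + single r c (-t),
    by rw [one_add_single_mul h.ne, add_neg_cancel, single_zero, add_zero],
    by rw [one_add_single_mul h.ne, neg_add_cancel, single_zero, add_zero]⟩

theorem one_add_single_apply {r c : Fin n} (h : r < c) (t : K) {a b : Fin n} (hab : ¬ a < b) :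
    (1 + single r c t : Matrix (Fin n) (Fin n) K) a b = (1 : Matrix (Fin n) (Fin n) K) a b := by
  rw [Matrix.add_apply, Matrix.single_apply_of_ne, add_zero]
  rintro ⟨rfl, rfl⟩
  exact hab h

theorem rootElement_mem (r c : Fin n) (h : r < c) (t : K) :
    rootElement r c h t ∈ upperUnipotent K n :=
  fun _ _ _ hab => one_add_single_apply h t hab

theorem one_add_single_lower {r c : Fin n} (h : r < c) (t : K) (a b : Fin n) (hab : b < a) :
    (1 + single r c t : Matrix (Fin n) (Fin n) K) a b = 0 := by
  rw [one_add_single_apply h t hab.not_gt, one_apply_ne hab.ne']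

variable {F : AF K (fun _ : Fin 1 => n)} {J : Fin 1 → Matrix (Fin n) (Fin n) K}

/-- An AF on U_n sees only the simple root groups: for s strictly between r and c, the product (1 +
E_rs)(1 + E_sc) contains the extra term E_rc, so additivity forces the entry of J at (c, r) to
vanish. -/
theorem AF.IsJ.apply_eq_zero (hF : F.dom = upperUnipotent K n) (h : F.IsJ J) {c r : Fin n}
    (hcr : J 0 c r ≠ 0) : (c : ℕ) = r + 1 := by
  have hlt : r < c := by
    obtain ⟨u, hu, hJ⟩ := h.2
    rw [hF] at hu
    by_contra hrc
    refine hcr ?_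
    have h1 := congrFun (congrFun (hJ 0) r) c
    rw [transpose_apply] at h1
    rw [h1, Matrix.sub_apply, hu 0 r c hrc, sub_self]
  by_contra hne
  rw [Fin.lt_def] at hlt
  let s : Fin n := ⟨r + 1, by omega⟩
  have hrs : r < s := by rw [Fin.lt_def]; simp [s]
  have hsc : s < c := by rw [Fin.lt_def]; simp only [s]; omega
  have hu : rootElement r s hrs (1 : K) ∈ F.dom := hF ▸ rootElement_mem r s hrs 1
  have hv : rootElement s c hsc (1 : K) ∈ F.dom := hF ▸ rootElement_mem s c hsc 1
  have h1 := F.fn_mul hu hv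
  rw [← h.traceForm_eq hu, ← h.traceForm_eq hv, ← h.traceForm_eq (mul_mem hu hv)] at h1
  have h0 := h.traceForm_one
  simp only [traceForm, LinearMap.coe_mk, AddHom.coe_mk, Fin.sum_univ_one, Pi.one_apply,
    mul_one, GLProd.val, MonoidHom.coe_mk, OneHom.coe_mk, rootElement, Pi.mul_apply,
    Units.val_mul] at h0 h1
  rw [add_mul, one_mul, mul_add (single r s (1 : K)), mul_one, single_mul_single_same] at h1
  simp only [mul_add, mul_one, trace_add, trace_mul_single, h0] at h1
  apply hcr
  simp only [MulOpposite.op_one, one_smul] at h1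
  linear_combination h1

variable {k : ℕ} {m : Fin k → ℕ}

theorem diagBlock_add {d : ℕ} (x : ℕ) (hx : x + d ≤ n) (A B : Matrix (Fin n) (Fin n) K) :
    diagBlock x hx (A + B) = diagBlock x hx A + diagBlock x hx B := rfl

/-- The transpose of `diagBlock` with respect to the trace form. -/
def diagEmbed {d : ℕ} (x : ℕ) (hx : x + d ≤ n) (X : Matrix (Fin d) (Fin d) K) :
    Matrix (Fin n) (Fin n) K :=
  (1 : Matrix (Fin n) (Fin n) K).submatrix id (fun r : Fin d => ⟨x + r, by omega⟩) * X *
    (1 : Matrix (Fin n) (Fin n) K).submatrix (fun r : Fin d => ⟨x + r, by omega⟩) id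

theorem trace_mul_diagBlock {d : ℕ} (x : ℕ) (hx : x + d ≤ n) (X : Matrix (Fin d) (Fin d) K)
    (A : Matrix (Fin n) (Fin n) K) :
    (X * diagBlock x hx A).trace = (diagEmbed x hx X * A).trace := by
  have h : diagBlock x hx A = (1 : Matrix (Fin n) (Fin n) K).submatrix
      (fun r : Fin d => ⟨x + r, by omega⟩) id * A *
      (1 : Matrix (Fin n) (Fin n) K).submatrix id (fun r : Fin d => ⟨x + r, by omega⟩) := by
    ext r c
    simp [diagBlock, Matrix.mul_apply, Matrix.one_apply]
  rw [h, diagEmbed, ← Matrix.mul_assoc, Matrix.trace_mul_comm]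
  simp only [Matrix.mul_assoc]

theorem rank_diagEmbed_le {d : ℕ} (x : ℕ) (hx : x + d ≤ n) (X : Matrix (Fin d) (Fin d) K) :
    (diagEmbed x hx X).rank ≤ X.rank :=
  (rank_mul_le_left _ _).trans (rank_mul_le_right _ _)

variable [CharZero K]

/-- Both sides are the differential of the diagonal image of F in the direction of the image of
E_rc. Only r < c is available, since the Lie algebra of U_n is strictly upper triangular; the trace
form swaps the indices. -/
theorem AF.Represents.diagEmbed_apply {hn : IsGreatest (Set.range m) n} {x : Fin k → ℕ}
    {hx : ∀ i, x i + m i ≤ n} (hF : F.dom = upperUnipotent K n) (hJ : F.IsJ J) {X : MatProd K m}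
    (hX : (F.diag hn x hx hF.le).Represents X) {r c : Fin n} (hrc : r < c) :
    (∑ i, diagEmbed (x i) (hx i) (X i)) c r = J 0 c r := by
  set N : MatProd K m := fun i => diagBlock (x i) (hx i) (single r c 1) with hN
  have hdiag : ∀ i (t : K), diagBlock (x i) (hx i) (1 + single r c t) *
      diagBlock (x i) (hx i) (1 + single r c (-t)) = 1 := by
    intro i t
    rw [← diagBlock_mul _ _ _ _ (one_add_single_lower hrc t) (one_add_single_lower hrc (-t)),
      one_add_single_mul hrc.ne, add_neg_cancel, single_zero, add_zero, diagBlock_one]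
  let h : K → GLProd K m := fun t i => ⟨_, _, hdiag i t, by simpa using hdiag i (-t)⟩
  have hmem : ∀ t, rootElement r c hrc t ∈ F.dom := fun t => hF ▸ rootElement_mem r c hrc t
  have hd : ∀ t, IsDiag x hx (rootElement r c hrc t) (h t) := fun t i => rfl
  have hval : ∀ t, GLProd.val (h t) = 1 + t • N := by
    intro t
    funext i
    change diagBlock (x i) (hx i) (1 + single r c t) =
      1 + t • diagBlock (x i) (hx i) (single r c 1)
    rw [diagBlock_add, diagBlock_one]
    ext a b
    simp [diagBlock, single_apply]
  have h0 := hJ.traceForm_one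
  have hfn : ∀ t, (F.diag hn x hx hF.le).fn (h t) = t * J 0 c r := by
    intro t
    rw [AF.fn_eq _ (AF.mem_diag.mpr ⟨_, hmem t, hd t⟩), AF.diag_apply _ _ _ _ _ _ (hmem t) _ (hd t),
      ← F.fn_eq, ← hJ.traceForm_eq (hmem t)]
    simp only [traceForm, LinearMap.coe_mk, AddHom.coe_mk, Fin.sum_univ_one, Pi.one_apply,
      mul_one, GLProd.val, MonoidHom.coe_mk, OneHom.coe_mk, rootElement] at h0 ⊢
    rw [mul_add, mul_one, trace_add, h0, trace_mul_single]
    simp [mul_comm]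
  have h1 := (F.diag hn x hx hF.le).isLie_of_curve (u := h)
    (fun t => AF.mem_diag.mpr ⟨_, hmem t, hd t⟩) (const_mem_polyCurve N) hval
  have h2 := hX N h1.1
  rw [h1.2 _ hfn] at h2
  rw [← h2]
  change _ = ∑ i, (X i * diagBlock (x i) (hx i) (single r c 1)).trace
  simp only [trace_mul_diagBlock, trace_mul_single]
  simp [Matrix.sum_apply]

end Diagonal

/-! ### The inequality between the orbits -/

theorem proposition1p14 {K : Type*} [Field K] [CharZero K] {k n : ℕ} (m : Fin k → ℕ)
    (hn : IsGreatest (Set.range m) n) (x : Fin k → ℕ) (hx : ∀ i, x i + m i ≤ n)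
    (F : AF K (fun _ : Fin 1 => n)) (hF : F.dom = upperUnipotent K n)
    (b : Nat.Partition n) (hb : F.HasOrbit (fun _ => b))
    (a : (i : Fin k) → Nat.Partition (m i))
    (F' : AF K m) (hF' : F'.IsParabolic) (ha : F'.HasOrbit a)
    (hpath : (F.diag hn x hx hF.le).HasPath F') :
    (b.parts.map fun t => t - 1).sum ≤ ∑ i, ((a i).parts.map fun t => t - 1).sum := by
  obtain ⟨J, hJ, hJb⟩ := hb
  obtain ⟨J', hJ', hJa⟩ := ha
  obtain ⟨g, hg⟩ := hpath.exists_represents hJ'.represents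
  rw [← (hJb 0).rank_eq]
  calc (J 0).rank ≤ (∑ i, diagEmbed (x i) (hx i) (g.ad J' i)).rank :=
        Matrix.rank_le_rank_of_subdiagonal (fun _ _ => hJ.apply_eq_zero hF)
          fun _ _ hrc => hg.diagEmbed_apply hF hJ hrc
    _ ≤ ∑ i, (diagEmbed (x i) (hx i) (g.ad J' i)).rank := Matrix.rank_sum_le _ _
    _ ≤ ∑ i, (g.ad J' i).rank := Finset.sum_le_sum fun i _ => rank_diagEmbed_le _ _ _
    _ = ∑ i, ((a i).parts.map fun t => t - 1).sum := Finset.sum_congr rfl fun i _ => by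
        rw [← (hJa i).rank_eq]
        exact rank_conj_units (g i) (J' i)
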